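/- Let $X=\{x\in\mathbb{R}^n : x\ge 0,\ Ax=b\}$ be a polyhedral domain containing a Slater point (a point of $X$ with all coordinates positive), let $\|\cdot\|$ be a norm on $\mathbb{R}^n$ with dual norm $\|\cdot\|_*$, let $F:X\to\mathbb{R}^n$ be $L$-Lipschitz ($L>0$), i.e. $\|F(x')-F(x)\|_*\le L\|x'-x\|$ on $X$, and let $x^*\in X$ satisfy $\langle F(x^*),x-x^*\rangle\ge0$ for all $x\in X$. Suppose that, for some $\alpha>0$ and some convex neighborhood $B$ of $x^*$ in $X$, $\langle F(x)-F(x^*),x-x^*\rangle\ge\alpha\|x-x^*\|^2$ for all $x\in B$. Let $h$ be a Bregman regularizer on $X$, that is, a proper, lower semicontinuous, strictly convex function $h:\mathbb{R}^n\to\mathbb{R}\cup\{\infty\}$ with domain $X$ whose subdifferential has a continuous selection $\nabla h$ on $\operatorname{dom}\partial h$ such that $h(x')\ge h(x)+\langle\nabla h(x),x'-x\rangle+\frac12\|x'-x\|^2$ for all $x\in\operatorname{dom}\partial h$, $x'\in X$. Suppose that $h$ is decomposable with kernel $\theta$: $h(x)=\sum_i\theta(x_i)$ on $X$, where $\theta:[0,\infty)\to\mathbb{R}$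 is continuous, and is twice differentiable on $(0,\infty)$ with $\theta''>0$ and $\theta''$ locally Lipschitz there. Write $D(p,x)=h(p)-h(x)-\langle\nabla h(x),p-x\rangle$ and $P_x(v)=\operatorname{argmin}_{x'\in X}\{\langle v,x-x'\rangle+D(x',x)\}$ for $x\in\operatorname{dom}\partial h$. Consider the Bregman proximal method with constant step-size $\gamma>0$, $$X_{t+1/2}=P_{X_t}\bigl(-\gamma[\,aF(X_t)+cF(X_{t-1/2})]\bigr),\qquad X_{t+1}=P_{X_t}\bigl(-\gamma F(X_{t+1/2})\bigr),\qquad t=1,2,\dots,\qquad X_{1/2}=X_1,$$ where $a,c\in[0,1]$, $a+c\le1$, and $a+c=1$ if $c>0$. Suppose that, with $\varphi=(1+\sqrt5)/2$, $$\gamma\le\frac1{2\varphi L},\qquad \gamma(1-a-c)^2\le\frac{\alpha}{8L^2},$$ and that $X_1\in\operatorname{dom}\partial h$ is sufficiently close to $x^*$. Let $(s_i)$ be slackness coefficients at $x^*$: numbers $s_i\ge0$, for $i$ in the active set $\mathcal{A}=\{i:x^*_i=0\}$, with $F(x^*)-\sum_{i\in\mathcal{A}}s_ie_i$ in the row space of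 $A$. A coordinate $i\in\mathcal{A}$ is called sharp if $s_i>0$ and flat if $s_i=0$; let $\mu$ be the minimum of $s_i$ over the sharp coordinates. Then there is a constant $\varrho\ge1$, depending only on $X$ and $x^*$, such that, with $\mu_{\rm eff}=\mu$ if there are no flat coordinates (that is, if $F$ is sharp at $x^*$) and $\mu_{\rm eff}=\mu/\varrho$ otherwise, the following holds for every sharp coordinate $i$: (a) if $\theta$ is Euclidean-like, $\liminf_{z\to0^+}\theta'(z)>-\infty$, then there is $T\ge1$ with $X_{i,t}=0$ for all $t\ge T$; (b) if $\theta$ is entropy-like, $\liminf_{z\to0^+}[\theta'(z)-\log z]>-\infty$, then $X_{i,t}=O\bigl(\exp(-\gamma\mu_{\rm eff}t/2)\bigr)$ as $t\to\infty$; (c) if $\theta$ is power-like with exponent $q\in(0,1)$, $\liminf_{z\to0^+}z^q\theta'(z)>-\infty$, then $X_{i,t}=O\bigl((\gamma\mu_{\rm eff}t/2)^{-1/q}\bigr)$ as $t\to\infty$. -/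

import Mathlib

open Set Filter Topology Asymptotics
open scoped Matrix

noncomputable section

namespace BregmanProx

variable {n : ℕ}

/-! ### Norms and variational inequalities on `ℝⁿ` -/

/-- The dual `max {⟨y, x⟩ : N x ≤ 1}` of the norm `N` on `ℝⁿ`, relative to the Euclidean pairing. -/
def dualNorm (N : Seminorm ℝ (Fin n → ℝ)) (y : Fin n → ℝ) : ℝ :=
  sSup ((fun x => y ⬝ᵥ x) '' {x | N x ≤ 1})

/-- `xs` solves the variational inequality of `F` on `X`. -/
def IsVISolution (X : Set (Fin n → ℝ)) (F : (Fin n → ℝ) → (Fin n → ℝ)) (xs : Fin n → ℝ) : Prop :=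
  xs ∈ X ∧ ∀ x ∈ X, 0 ≤ F xs ⬝ᵥ (x - xs)

/-- `F` is `L`-Lipschitz on `X`, from the norm `N` to its dual norm. -/
def LipschitzField (X : Set (Fin n → ℝ)) (N : Seminorm ℝ (Fin n → ℝ))
    (F : (Fin n → ℝ) → (Fin n → ℝ)) (L : ℝ) : Prop :=
  ∀ x ∈ X, ∀ x' ∈ X, dualNorm N (F x' - F x) ≤ L * N (x' - x)

/-- Second-order sufficiency at `xs` with modulus `α`, on some convex neighborhood of `xs` in `X`. -/
def SecondOrderSufficient (X : Set (Fin n → ℝ)) (N : Seminorm ℝ (Fin n → ℝ))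
    (F : (Fin n → ℝ) → (Fin n → ℝ)) (xs : Fin n → ℝ) (α : ℝ) : Prop :=
  0 < α ∧ ∃ B ⊆ X, Convex ℝ B ∧ B ∈ 𝓝[X] xs ∧
    ∀ x ∈ B, α * N (x - xs) ^ 2 ≤ (F x - F xs) ⬝ᵥ (x - xs)

/-! ### Bregman regularizers

A function `ℝⁿ → ℝ ∪ {∞}` with domain `X` is represented by its (real) values on `X`;
values of `h` outside `X` are never used. -/

/-- The subdifferential at `x` of the function equal to `h` on `X` and to `∞` elsewhere. -/
def subdifferential (X : Set (Fin n → ℝ)) (h : (Fin n → ℝ) → ℝ) (x : Fin n → ℝ) :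
    Set (Fin n → ℝ) :=
  {v | x ∈ X ∧ ∀ x' ∈ X, h x + v ⬝ᵥ (x' - x) ≤ h x'}

/-- The prox-domain, i.e. the domain of the subdifferential. -/
def proxDomain (X : Set (Fin n → ℝ)) (h : (Fin n → ℝ) → ℝ) : Set (Fin n → ℝ) :=
  {x | (subdifferential X h x).Nonempty}

/-- `h` (extended by `∞` outside `X`) is a Bregman regularizer on `X`, and `g` is a continuous
selection of its subdifferential. -/
structure IsBregmanRegularizer (X : Set (Fin n → ℝ)) (N : Seminorm ℝ (Fin n → ℝ))
    (h : (Fin n → ℝ) → ℝ) (g : (Fin n → ℝ) → (Fin n → ℝ)) : Prop where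
  nonempty : X.Nonempty
  isClosed : IsClosed X
  lowerSemicontinuousOn : LowerSemicontinuousOn h X
  strictConvexOn : StrictConvexOn ℝ X h
  selection_mem : ∀ x ∈ proxDomain X h, g x ∈ subdifferential X h x
  selection_continuousOn : ContinuousOn g (proxDomain X h)
  strongly_convex : ∀ x ∈ proxDomain X h, ∀ x' ∈ X,
    h x + g x ⬝ᵥ (x' - x) + 1 / 2 * N (x' - x) ^ 2 ≤ h x'

/-- The Bregman divergence `D(p, x)`. -/
def bregDiv (h : (Fin n → ℝ) → ℝ) (g : (Fin n → ℝ) → (Fin n → ℝ)) (p x : Fin n → ℝ) : ℝ :=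
  h p - h x - g x ⬝ᵥ (p - x)

/-- `z` is the value at `y` of the prox-mapping based at `x`:
`z = argmin_{x' ∈ X} { ⟨y, x - x'⟩ + D(x', x) }` with `x` in the prox-domain. -/
def IsProx (X : Set (Fin n → ℝ)) (h : (Fin n → ℝ) → ℝ) (g : (Fin n → ℝ) → (Fin n → ℝ))
    (x y z : Fin n → ℝ) : Prop :=
  x ∈ proxDomain X h ∧ z ∈ X ∧ IsMinOn (fun x' => y ⬝ᵥ (x - x') + bregDiv h g x' x) X z

/-- A run of the Bregman proximal method with constant step-size `γ` and signal coefficients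
`a, b`. The base state `X_t` is `x t` for `t ≥ 1` (`x 0` plays no role), and the leading state
`X_{t+1/2}` is `y t` for `t ≥ 0`. -/
structure IsBPMRun (X : Set (Fin n → ℝ)) (h : (Fin n → ℝ) → ℝ) (g : (Fin n → ℝ) → (Fin n → ℝ))
    (F : (Fin n → ℝ) → (Fin n → ℝ)) (a b γ : ℝ) (x y : ℕ → (Fin n → ℝ)) : Prop where
  init : y 0 = x 1
  lead : ∀ t, 1 ≤ t → IsProx X h g (x t) (-(γ • (a • F (x t) + b • F (y (t - 1))))) (y t)
  next : ∀ t, 1 ≤ t → IsProx X h g (x t) (-(γ • F (y t))) (x (t + 1))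

/-- Admissible signal coefficients. -/
def AdmissibleSignal (a b : ℝ) : Prop :=
  a ∈ Icc (0 : ℝ) 1 ∧ b ∈ Icc (0 : ℝ) 1 ∧ a + b ≤ 1 ∧ (0 < b → a + b = 1)

/-! ### Polyhedral domains, slackness and sharpness -/

/-- The polyhedron `{x ≥ 0 : A x = b}`. -/
def polyhedron {m : ℕ} (A : Matrix (Fin m) (Fin n) ℝ) (b : Fin m → ℝ) : Set (Fin n → ℝ) :=
  {x | (∀ i, 0 ≤ x i) ∧ A *ᵥ x = b}

/-- `X` has a point all of whose coordinates are positive. -/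
def HasSlaterPoint (X : Set (Fin n → ℝ)) : Prop :=
  ∃ z ∈ X, ∀ i, 0 < z i

/-- The inequality constraints that are active at `xs`. -/
def activeCoords (xs : Fin n → ℝ) : Finset (Fin n) :=
  Finset.univ.filter fun i => xs i = 0

/-- The numbers `s i`, `i` active at `xs`, are slackness coefficients of the vector `v = F(xs)`:
they are nonnegative and `v - ∑ s i e_i` (sum over active `i`) is in the row space of `A`.
Values `s i` at inactive coordinates are never used. -/
def IsSlackness {m : ℕ} (A : Matrix (Fin m) (Fin n) ℝ) (xs v s : Fin n → ℝ) : Prop :=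
  (∀ i ∈ activeCoords xs, 0 ≤ s i) ∧
    v - ∑ i ∈ activeCoords xs, s i • (Pi.single i 1 : Fin n → ℝ) ∈
      Submodule.span ℝ (Set.range fun k : Fin m => A k)

/-- The sharp directions. -/
def sharpCoords (xs s : Fin n → ℝ) : Finset (Fin n) :=
  (activeCoords xs).filter fun i => 0 < s i

/-- The flat directions. -/
def flatCoords (xs s : Fin n → ℝ) : Finset (Fin n) :=
  (activeCoords xs).filter fun i => s i = 0

/-- The sharpness `μ = min {s i : i sharp}` (only meaningful when there is a sharp direction). -/
def sharpness (xs s : Fin n → ℝ) : ℝ :=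
  sInf (s '' (sharpCoords xs s : Set (Fin n)))

/-- The effective sharpness: `μ` if there is no flat direction, and `μ / ρ` otherwise. -/
def effSharpness (ρ : ℝ) (xs s : Fin n → ℝ) : ℝ :=
  if flatCoords xs s = ∅ then sharpness xs s else sharpness xs s / ρ

/-! ### Decomposable regularizers and their kernels -/

/-- `h` is decomposable on `X` with kernel `θ : [0, ∞) → ℝ` (values of `θ` at negative numbers
are never used). -/
structure IsDecomposable (X : Set (Fin n → ℝ)) (h : (Fin n → ℝ) → ℝ) (θ : ℝ → ℝ) : Prop where
  eq_sum : ∀ x ∈ X, h x = ∑ i, θ (x i)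
  continuousOn : ContinuousOn θ (Ici 0)
  contDiffOn : ContDiffOn ℝ 2 θ (Ioi 0)
  deriv2_pos : ∀ z, 0 < z → 0 < deriv (deriv θ) z
  deriv2_locallyLipschitz : LocallyLipschitzOn (Ioi 0) (deriv (deriv θ))

/-- `liminf_{z → 0+} θ'(z) > -∞`. -/
def EuclideanLike (θ : ℝ → ℝ) : Prop :=
  (⊥ : EReal) < liminf (fun z : ℝ => ((deriv θ z : ℝ) : EReal)) (𝓝[>] 0)

/-- `liminf_{z → 0+} [θ'(z) - log z] > -∞`. -/
def EntropyLike (θ : ℝ → ℝ) : Prop :=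
  (⊥ : EReal) < liminf (fun z : ℝ => ((deriv θ z - Real.log z : ℝ) : EReal)) (𝓝[>] 0)

/-- `liminf_{z → 0+} z ^ q * θ'(z) > -∞`. -/
def PowerLike (q : ℝ) (θ : ℝ → ℝ) : Prop :=
  (⊥ : EReal) < liminf (fun z : ℝ => ((z ^ q * deriv θ z : ℝ) : EReal)) (𝓝[>] 0)

end BregmanProx

end

namespace BregmanProx

variable {n : ℕ}

/-! ### Norms on `ℝⁿ` and Lipschitz fields -/

/-! The proof has two halves: the run converges to `xs`, and convergence then turns slackness into
rates.

Convergence: the energy `D(xs, X_t) + N(X_t - X_{t-1/2})² / 4` decreases by multiples of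
`N(X_{t+1/2} - xs)²` and `N(X_{t+1/2} - X_t)²` whenever the leading state lies where second-order
sufficiency holds (`energy_step`). A small energy keeps it there (`lead_mem_ball`), so both
sequences tend to `xs` (`run_tendsto`). A start near `xs` has small energy by Bregman reciprocity
(`eventually_bregDiv_le`).

Rates: let `w` be in the kernel of `A`, nonnegative on the active set, with `w i > 0` at a sharp
`i`. Slackness gives `⟨F xs, w⟩ = ∑ s j * w j > 0`, so each prox step pushes `⟨∇h(X_t), w⟩` down by
about `γ⟨F xs, w⟩`. If `θ'` is bounded below, `∇h` is continuous at `xs`, so its increments vanish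
and cannot absorb this push; coordinate `i` must become zero (`eventually_eq_zero_of_lowerBound`).
Otherwise iterates are positive, prox steps are equalities on the kernel of `A`, and telescoping
bounds `∑ θ'(X_{j,t}) * w j` above by a linearly decreasing function of `t`. To isolate coordinate
`i`, `w` must be supported, within the active set, where `X_{j,t}` is at least a fixed multiple of
`X_{i,t}`. A finite family of directions, one for each possible support, always contains such a `w`
(`exists_direction_le`), and `eventually_deriv_le` follows. The growth condition on `θ'` converts
this into the stated rate. -/

lemma seminorm_continuous (N : Seminorm ℝ (Fin n → ℝ)) : Continuous N :=
  continuousOn_univ.1 (N.convexOn.continuousOn isOpen_univ)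

lemma exists_mul_norm_le_seminorm (N : Seminorm ℝ (Fin n → ℝ)) (hN : ∀ x, N x = 0 → x = 0) :
    ∃ c > 0, ∀ x, c * ‖x‖ ≤ N x := by
  rcases (Metric.sphere (0 : Fin n → ℝ) 1).eq_empty_or_nonempty with he | hne
  · refine ⟨1, one_pos, fun x => ?_⟩
    have hx : x = 0 := by
      by_contra hx
      have : (‖x‖⁻¹ • x) ∈ Metric.sphere (0 : Fin n → ℝ) 1 := by
        simp [norm_smul, norm_ne_zero_iff.2 hx]
      simp [he] at this
    simp [hx]
  · obtain ⟨u, hu, hmin⟩ := (isCompact_sphere (0 : Fin n → ℝ) 1).exists_isMinOn hne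
      (seminorm_continuous N).continuousOn
    have hu0 : u ≠ 0 := by
      rintro rfl
      simp at hu
    refine ⟨N u, lt_of_le_of_ne (apply_nonneg N u) (fun h => hu0 (hN u h.symm)), fun x => ?_⟩
    by_cases hx : x = 0
    · simp [hx]
    have hx' : 0 < ‖x‖ := norm_pos_iff.2 hx
    have h1 : N u ≤ N (‖x‖⁻¹ • x) := hmin (by simp [norm_smul, hx])
    rw [map_smul_eq_mul, norm_inv, norm_norm] at h1
    calc N u * ‖x‖ ≤ ‖x‖⁻¹ * N x * ‖x‖ := by gcongr
      _ = N x := by field_simp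

/-- The real `sSup` in `dualNorm` carries information only for a bounded set; definiteness of `N`
supplies the bound, through comparison with the sup norm. -/
lemma dotProduct_le_dualNorm_mul (N : Seminorm ℝ (Fin n → ℝ)) (hN : ∀ x, N x = 0 → x = 0)
    (y v : Fin n → ℝ) : y ⬝ᵥ v ≤ dualNorm N y * N v := by
  obtain ⟨c, hc, hcN⟩ := exists_mul_norm_le_seminorm N hN
  have hbdd : BddAbove ((fun x => y ⬝ᵥ x) '' {x | N x ≤ 1}) := by
    refine ⟨∑ i, |y i| * c⁻¹, ?_⟩
    rintro _ ⟨x, hx, rfl⟩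
    refine Finset.sum_le_sum fun i _ => ?_
    have h1 : |x i| ≤ c⁻¹ := by
      have := (hcN x).trans hx
      calc |x i| ≤ ‖x‖ := norm_le_pi_norm x i
        _ ≤ c⁻¹ := by rwa [← one_div, le_div_iff₀' hc]
    calc y i * x i ≤ |y i * x i| := le_abs_self _
      _ = |y i| * |x i| := abs_mul _ _
      _ ≤ |y i| * c⁻¹ := by gcongr
  by_cases hv : v = 0
  · simp [hv]
  have hNv : 0 < N v := lt_of_le_of_ne (apply_nonneg N v) (fun h => hv (hN v h.symm))
  have h1 : y ⬝ᵥ ((N v)⁻¹ • v) ≤ dualNorm N y := by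
    refine le_csSup hbdd ⟨_, ?_, rfl⟩
    simp [map_smul_eq_mul, abs_of_pos hNv, hNv.ne']
  rw [dotProduct_smul, smul_eq_mul] at h1
  calc y ⬝ᵥ v = (N v)⁻¹ * (y ⬝ᵥ v) * N v := by field_simp
    _ ≤ _ := by gcongr

lemma LipschitzField.dotProduct_le {X : Set (Fin n → ℝ)} {N : Seminorm ℝ (Fin n → ℝ)}
    {F : (Fin n → ℝ) → (Fin n → ℝ)} {L : ℝ} (hF : LipschitzField X N F L)
    (hN : ∀ x, N x = 0 → x = 0) {x x' : Fin n → ℝ} (hx : x ∈ X) (hx' : x' ∈ X) (v : Fin n → ℝ) :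
    (F x' - F x) ⬝ᵥ v ≤ L * N (x' - x) * N v :=
  (dotProduct_le_dualNorm_mul N hN _ v).trans
    (mul_le_mul_of_nonneg_right (hF x hx x' hx') (apply_nonneg N v))

/-! ### Kernels of decomposable regularizers -/

section Kernel

variable {X : Set (Fin n → ℝ)} {h : (Fin n → ℝ) → ℝ} {θ : ℝ → ℝ}

lemma IsDecomposable.differentiableAt (hd : IsDecomposable X h θ) {z : ℝ} (hz : 0 < z) :
    DifferentiableAt ℝ θ z :=
  (hd.contDiffOn.differentiableOn (by norm_num)).differentiableAt (Ioi_mem_nhds hz)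

lemma IsDecomposable.strictConvexOn (hd : IsDecomposable X h θ) :
    StrictConvexOn ℝ (Ici 0) θ := by
  refine strictConvexOn_of_deriv2_pos (convex_Ici 0) hd.continuousOn fun z hz => ?_
  rw [interior_Ici] at hz
  exact hd.deriv2_pos z hz

lemma IsDecomposable.monotoneOn_deriv (hd : IsDecomposable X h θ) :
    MonotoneOn (deriv θ) (Ioi 0) :=
  ((hd.strictConvexOn.subset Ioi_subset_Ici_self (convex_Ioi 0)).strictMonoOn_deriv
    fun _ hz => hd.differentiableAt hz).monotoneOn

lemma IsDecomposable.continuousOn_deriv (hd : IsDecomposable X h θ) :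
    ContinuousOn (deriv θ) (Ioi 0) :=
  hd.contDiffOn.continuousOn_deriv_of_isOpen isOpen_Ioi (by norm_num)

lemma IsDecomposable.tangent_le (hd : IsDecomposable X h θ) {z z' : ℝ} (hz : 0 < z)
    (hz' : 0 ≤ z') : θ z + deriv θ z * (z' - z) ≤ θ z' := by
  have hc := hd.strictConvexOn.convexOn
  rcases lt_trichotomy z z' with hlt | rfl | hlt
  · have := hc.deriv_le_slope hz.le hz' hlt (hd.differentiableAt hz)
    rw [slope_def_field, le_div_iff₀ (by linarith)] at this
    linarith
  · simp
  · have := hc.slope_le_deriv hz' hz.le hlt (hd.differentiableAt hz)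
    rw [slope_def_field, div_le_iff₀ (by linarith)] at this
    linarith

lemma IsDecomposable.lowerBound_mul_le (hd : IsDecomposable X h θ) {M : ℝ}
    (hM : ∀ z, 0 < z → M ≤ deriv θ z) {z : ℝ} (hz : 0 ≤ z) : θ 0 + M * z ≤ θ z := by
  have := (convex_Ici (0 : ℝ)).mul_sub_le_image_sub_of_le_deriv hd.continuousOn
    (by rw [interior_Ici]; exact fun z hz => (hd.differentiableAt hz).differentiableWithinAt)
    (by rw [interior_Ici]; exact hM) 0 (by simp) z hz hz
  simp only [sub_zero] at this
  linarith

lemma IsDecomposable.continuousOn_regularizer (hd : IsDecomposable X h θ)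
    (hX : ∀ x ∈ X, ∀ i, 0 ≤ x i) : ContinuousOn h X := by
  refine ContinuousOn.congr ?_ hd.eq_sum
  exact continuousOn_finsetSum _ fun i _ =>
    hd.continuousOn.comp (continuous_apply i).continuousOn fun x hx => hX x hx i

end Kernel

/-! ### Polyhedra and prox-domains -/

section Polyhedron

variable {m : ℕ} {A : Matrix (Fin m) (Fin n) ℝ} {b : Fin m → ℝ}

lemma polyhedron_nonneg : ∀ x ∈ polyhedron A b, ∀ i, 0 ≤ x i := fun _ hx => hx.1

lemma mulVec_sub_eq_zero {x x' : Fin n → ℝ} (hx : x ∈ polyhedron A b)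
    (hx' : x' ∈ polyhedron A b) : A *ᵥ (x' - x) = 0 := by
  rw [Matrix.mulVec_sub, hx.2, hx'.2, sub_self]

lemma eventually_add_smul_mem_polyhedron {x w : Fin n → ℝ} (hx : x ∈ polyhedron A b)
    (hw : A *ᵥ w = 0) (hpos : ∀ j, x j = 0 → 0 ≤ w j) :
    ∀ᶠ ε : ℝ in 𝓝[>] 0, x + ε • w ∈ polyhedron A b := by
  have h1 : ∀ j, ∀ᶠ ε : ℝ in 𝓝[>] 0, 0 ≤ x j + ε * w j := by
    intro j
    rcases (hx.1 j).eq_or_lt with h0 | h0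
    · filter_upwards [self_mem_nhdsWithin] with ε hε
      rw [← h0, zero_add]
      exact mul_nonneg (le_of_lt hε) (hpos j h0.symm)
    · have : Tendsto (fun ε : ℝ => x j + ε * w j) (𝓝[>] 0) (𝓝 (x j + 0 * w j)) :=
        tendsto_nhdsWithin_of_tendsto_nhds (Continuous.tendsto (by fun_prop) 0)
      filter_upwards [this.eventually (lt_mem_nhds (by simpa using h0))] with ε hε using hε.le
  filter_upwards [eventually_all.2 h1] with ε hε
  exact ⟨fun j => by simpa using hε j, by
    rw [Matrix.mulVec_add, Matrix.mulVec_smul, hw, smul_zero, add_zero, hx.2]⟩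

lemma convex_polyhedron : Convex ℝ (polyhedron A b) := by
  intro x hx y hy s t hs ht hst
  refine ⟨fun i => ?_, ?_⟩
  · simp only [Pi.add_apply, Pi.smul_apply, smul_eq_mul]
    have := hx.1 i
    have := hy.1 i
    positivity
  · rw [Matrix.mulVec_add, Matrix.mulVec_smul, Matrix.mulVec_smul, hx.2, hy.2, ← add_smul, hst,
      one_smul]

variable {h : (Fin n → ℝ) → ℝ} {θ : ℝ → ℝ}

lemma mem_proxDomain_of_pos (hd : IsDecomposable (polyhedron A b) h θ) {x : Fin n → ℝ}
    (hx : x ∈ polyhedron A b) (hpos : ∀ i, 0 < x i) : x ∈ proxDomain (polyhedron A b) h := by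
  refine ⟨fun i => deriv θ (x i), hx, fun x' hx' => ?_⟩
  rw [hd.eq_sum x hx, hd.eq_sum x' hx', dotProduct, ← Finset.sum_add_distrib]
  exact Finset.sum_le_sum fun i _ => hd.tangent_le (hpos i) (hx'.1 i)

lemma mem_proxDomain_of_lowerBound (hd : IsDecomposable (polyhedron A b) h θ) {M : ℝ}
    (hM : ∀ z, 0 < z → M ≤ deriv θ z) {x : Fin n → ℝ} (hx : x ∈ polyhedron A b) :
    x ∈ proxDomain (polyhedron A b) h := by
  refine ⟨fun i => if 0 < x i then deriv θ (x i) else M, hx, fun x' hx' => ?_⟩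
  rw [hd.eq_sum x hx, hd.eq_sum x' hx', dotProduct, ← Finset.sum_add_distrib]
  refine Finset.sum_le_sum fun i _ => ?_
  split_ifs with hi
  · exact hd.tangent_le hi (hx'.1 i)
  · have h0 : x i = 0 := le_antisymm (not_lt.1 hi) (hx.1 i)
    rw [Pi.sub_apply, h0, sub_zero]
    exact hd.lowerBound_mul_le hM (hx'.1 i)

/-- Move from `x` a fraction `l` of the way to a Slater point. If `x k = 0`, coordinate `k` lowers
`h` faster than any linear rate in `l`, while the other coordinates raise it at most linearly by
convexity. No subgradient can exist there. -/
lemma pos_of_mem_proxDomain (hd : IsDecomposable (polyhedron A b) h θ)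
    (hS : HasSlaterPoint (polyhedron A b)) (hθ : ∀ M, ∃ z, 0 < z ∧ deriv θ z < M)
    {x : Fin n → ℝ} (hx : x ∈ proxDomain (polyhedron A b) h) (k : Fin n) : 0 < x k := by
  obtain ⟨v, hxX, hv⟩ := hx
  obtain ⟨z, hzX, hz⟩ := hS
  by_contra hk
  have h0 : x k = 0 := le_antisymm (not_lt.1 hk) (hxX.1 k)
  set R : ℝ := ∑ j ∈ Finset.univ.erase k, (θ (z j) - θ (x j)) with hR
  obtain ⟨ζ, hζ, hζM⟩ := hθ ((v ⬝ᵥ (z - x) - R) / z k)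
  obtain ⟨l, hl0, hl1, hlζ⟩ : ∃ l : ℝ, 0 < l ∧ l < 1 ∧ l * z k < ζ := by
    have h1 : ∀ᶠ l : ℝ in 𝓝[>] 0, l * z k < ζ := by
      have : Tendsto (fun l : ℝ => l * z k) (𝓝[>] 0) (𝓝 (0 * z k)) :=
        tendsto_nhdsWithin_of_tendsto_nhds (Continuous.tendsto (by fun_prop) 0)
      exact this.eventually (gt_mem_nhds (by simpa using hζ))
    obtain ⟨l, h1, h2⟩ := (h1.and (Ioo_mem_nhdsGT one_pos)).exists
    exact ⟨l, h2.1, h2.2, h1⟩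
  have hlz : 0 < l * z k := mul_pos hl0 (hz k)
  have hmem : x + l • (z - x) ∈ polyhedron A b :=
    convex_polyhedron.add_smul_sub_mem hxX hzX ⟨hl0.le, hl1.le⟩
  have hsub := hv _ hmem
  rw [hd.eq_sum x hxX, hd.eq_sum _ hmem, add_sub_cancel_left, dotProduct_smul, smul_eq_mul,
    ← Finset.add_sum_erase _ _ (Finset.mem_univ k), ← Finset.add_sum_erase _ _ (Finset.mem_univ k)]
    at hsub
  have hk1 : (x + l • (z - x)) k = l * z k := by simp [h0]
  have hk2 : θ (l * z k) - θ 0 < l * (v ⬝ᵥ (z - x) - R) := by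
    have h1 := hd.tangent_le hlz le_rfl
    have h2 : deriv θ (l * z k) ≤ deriv θ ζ := hd.monotoneOn_deriv hlz hζ hlζ.le
    have h3 : deriv θ (l * z k) < (v ⬝ᵥ (z - x) - R) / z k := h2.trans_lt hζM
    rw [lt_div_iff₀ (hz k)] at h3
    nlinarith
  have hsum : ∑ j ∈ Finset.univ.erase k, θ ((x + l • (z - x)) j) ≤
      ∑ j ∈ Finset.univ.erase k, θ (x j) + l * R := by
    rw [hR, Finset.mul_sum, ← Finset.sum_add_distrib]
    refine Finset.sum_le_sum fun j _ => ?_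
    have := hd.strictConvexOn.convexOn.2 (hxX.1 j) (hzX.1 j) (sub_nonneg.2 hl1.le) hl0.le
      (sub_add_cancel 1 l)
    simp only [smul_eq_mul] at this
    have e : (x + l • (z - x)) j = (1 - l) * x j + l * z j := by
      simp only [Pi.add_apply, Pi.smul_apply, Pi.sub_apply, smul_eq_mul]; ring
    rw [e]
    linarith
  rw [hk1, h0] at hsub
  linarith

/-- If `θ'` is unbounded below, the prox-domain consists of the positive points, and positivity
survives along the segment short of `q`. If it is bounded below, the prox-domain is all of `X`. -/
lemma segment_mem_proxDomain (hd : IsDecomposable (polyhedron A b) h θ)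
    (hS : HasSlaterPoint (polyhedron A b)) {x q : Fin n → ℝ}
    (hx : x ∈ proxDomain (polyhedron A b) h) (hq : q ∈ polyhedron A b) {l : ℝ}
    (hl : l ∈ Ico (0 : ℝ) 1) : x + l • (q - x) ∈ proxDomain (polyhedron A b) h := by
  have hxX : x ∈ polyhedron A b := hx.choose_spec.1
  have hmem : x + l • (q - x) ∈ polyhedron A b :=
    convex_polyhedron.add_smul_sub_mem hxX hq ⟨hl.1, hl.2.le⟩
  by_cases hθ : ∀ M, ∃ z, 0 < z ∧ deriv θ z < M
  · refine mem_proxDomain_of_pos hd hmem fun i => ?_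
    have h1 := pos_of_mem_proxDomain hd hS hθ hx i
    have e : (x + l • (q - x)) i = (1 - l) * x i + l * q i := by
      simp only [Pi.add_apply, Pi.smul_apply, Pi.sub_apply, smul_eq_mul]; ring
    rw [e]
    exact add_pos_of_pos_of_nonneg (mul_pos (by linarith [hl.2]) h1) (mul_nonneg hl.1 (hq.1 i))
  · push Not at hθ
    obtain ⟨M, hM⟩ := hθ
    exact mem_proxDomain_of_lowerBound hd hM hmem

end Polyhedron

/-! ### The prox-mapping -/

section Prox

variable {X : Set (Fin n → ℝ)} {N : Seminorm ℝ (Fin n → ℝ)} {h : (Fin n → ℝ) → ℝ}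
  {g : (Fin n → ℝ) → (Fin n → ℝ)}

lemma proxDomain_subset : proxDomain X h ⊆ X := fun _ hx => hx.choose_spec.1

lemma IsProx.add_mem_subdifferential {x y z : Fin n → ℝ} (hp : IsProx X h g x y z) :
    g x + y ∈ subdifferential X h z := by
  refine ⟨hp.2.1, fun x' hx' => ?_⟩
  have := hp.2.2 hx'
  simp only [Set.mem_ofPred_eq, bregDiv, dotProduct_sub, add_dotProduct] at this ⊢
  linarith

lemma IsProx.mem_proxDomain {x y z : Fin n → ℝ} (hp : IsProx X h g x y z) :
    z ∈ proxDomain X h := ⟨_, hp.add_mem_subdifferential⟩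

/-- Optimality of `z` makes `g x + y` a subgradient at `z`, but possibly not the selected one.
Monotonicity of subgradients compares it with `g` at nearby points of the segment towards `q`, and
continuity of `g` passes to the limit at `z`. -/
lemma IsProx.dotProduct_le (hreg : IsBregmanRegularizer X N h g)
    (hseg : ∀ x ∈ proxDomain X h, ∀ q ∈ X, ∀ l ∈ Ico (0 : ℝ) 1, x + l • (q - x) ∈ proxDomain X h)
    {x y z q : Fin n → ℝ} (hp : IsProx X h g x y z) (hq : q ∈ X) :
    y ⬝ᵥ (q - z) ≤ (g z - g x) ⬝ᵥ (q - z) := by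
  have hz := hp.mem_proxDomain
  have key : ∀ l ∈ Ioo (0 : ℝ) 1, (g x + y) ⬝ᵥ (q - z) ≤ g (z + l • (q - z)) ⬝ᵥ (q - z) := by
    intro l hl
    have hm := hseg z hz q hq l ⟨hl.1.le, hl.2⟩
    have h1 := hp.add_mem_subdifferential.2 _ (proxDomain_subset hm)
    have h2 := (hreg.selection_mem _ hm).2 z hp.2.1
    rw [add_sub_cancel_left, dotProduct_smul, smul_eq_mul] at h1
    rw [sub_add_cancel_left, dotProduct_neg, dotProduct_smul, smul_eq_mul] at h2
    exact le_of_mul_le_mul_left (by linarith) hl.1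
  have hlim : Tendsto (fun l : ℝ => g (z + l • (q - z)) ⬝ᵥ (q - z)) (𝓝[>] 0)
      (𝓝 (g z ⬝ᵥ (q - z))) := by
    have hc : Tendsto (fun l : ℝ => z + l • (q - z)) (𝓝[>] 0) (𝓝[proxDomain X h] z) := by
      refine tendsto_nhdsWithin_iff.2 ⟨?_, ?_⟩
      · have : Tendsto (fun l : ℝ => z + l • (q - z)) (𝓝 0) (𝓝 (z + (0 : ℝ) • (q - z))) :=
          Continuous.tendsto (by fun_prop) 0
        rw [zero_smul, add_zero] at this
        exact tendsto_nhdsWithin_of_tendsto_nhds this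
      · filter_upwards [Ioo_mem_nhdsGT one_pos] with l hl
        exact hseg z hz q hq l ⟨hl.1.le, hl.2⟩
    have hg : Tendsto (fun l : ℝ => g (z + l • (q - z))) (𝓝[>] 0) (𝓝 (g z)) :=
      (hreg.selection_continuousOn z hz).tendsto.comp hc
    have hcont : Continuous fun v : Fin n → ℝ => v ⬝ᵥ (q - z) := by fun_prop
    exact (hcont.tendsto _).comp hg
  have := ge_of_tendsto hlim (by
    filter_upwards [Ioo_mem_nhdsGT one_pos] with l hl using key l hl)
  rw [add_dotProduct] at this
  rw [sub_dotProduct]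
  linarith

lemma IsProx.bregDiv_le (hreg : IsBregmanRegularizer X N h g)
    (hseg : ∀ x ∈ proxDomain X h, ∀ q ∈ X, ∀ l ∈ Ico (0 : ℝ) 1, x + l • (q - x) ∈ proxDomain X h)
    {x y z q : Fin n → ℝ} (hp : IsProx X h g x y z) (hq : q ∈ X) :
    bregDiv h g q z ≤ bregDiv h g q x - bregDiv h g z x - y ⬝ᵥ (q - z) := by
  have := hp.dotProduct_le hreg hseg hq
  simp only [bregDiv, dotProduct_sub, sub_dotProduct] at this ⊢
  linarith

lemma IsBregmanRegularizer.half_sq_le_bregDiv (hreg : IsBregmanRegularizer X N h g)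
    {x q : Fin n → ℝ} (hx : x ∈ proxDomain X h) (hq : q ∈ X) :
    1 / 2 * N (q - x) ^ 2 ≤ bregDiv h g q x := by
  have := hreg.strongly_convex x hx q hq
  rw [bregDiv]
  linarith

end Prox

/-! ### Local convergence -/

section Energy

variable {X : Set (Fin n → ℝ)} {N : Seminorm ℝ (Fin n → ℝ)} {h : (Fin n → ℝ) → ℝ}
  {g : (Fin n → ℝ) → (Fin n → ℝ)} {F : (Fin n → ℝ) → (Fin n → ℝ)} {L α : ℝ}

lemma sq_error_le {L α a c γ u d r w : ℝ} (hL : 0 < L) (hγ : 0 < γ) (hγL : γ * L ≤ 5 / 16)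
    (hac : AdmissibleSignal a c) (hγα : γ * (1 - a - c) ^ 2 ≤ α / (8 * L ^ 2))
    (hu : 0 ≤ u) (hd0 : 0 ≤ d) (hr : 0 ≤ r) (hw : 0 ≤ w) (hd : d ≤ u + w) :
    (γ * L) ^ 2 * (a * u + c * d + (1 - a - c) * r) ^ 2 ≤
      1 / 5 * u ^ 2 + 1 / 4 * w ^ 2 + 1 / 4 * (γ * α) * r ^ 2 := by
  obtain ⟨⟨ha0, ha1⟩, ⟨hc0, hc1⟩, hac1, hac2⟩ := hac
  have hk : (γ * L) ^ 2 ≤ 1 / 10 := by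
    have : 0 < γ * L := by positivity
    nlinarith
  have he : (γ * L) ^ 2 * (1 - a - c) ^ 2 ≤ γ * α / 8 := by
    rw [le_div_iff₀ (by positivity)] at hγα
    nlinarith
  have hα : 0 ≤ γ * α := by nlinarith [sq_nonneg (γ * L * (1 - a - c))]
  have hk0 : 0 ≤ (γ * L) ^ 2 := sq_nonneg _
  -- For `c = 0` the stale state drops out and the missing weight is paid for by `he`; for `c > 0`
  -- there is no missing weight and `d` is split by the triangle inequality.
  rcases hc0.eq_or_lt with rfl | hc
  · have h1 : (a * u + 0 * d + (1 - a - 0) * r) ^ 2 ≤ 2 * u ^ 2 + 2 * (1 - a - 0) ^ 2 * r ^ 2 := by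
      have : (a * u) ^ 2 ≤ u ^ 2 := by
        have h2 : a * u ≤ u := by nlinarith
        have h3 : 0 ≤ a * u := by positivity
        nlinarith
      nlinarith [sq_nonneg (a * u - (1 - a - 0) * r)]
    calc _ ≤ (γ * L) ^ 2 * (2 * u ^ 2 + 2 * (1 - a - 0) ^ 2 * r ^ 2) := by gcongr
      _ = 2 * (γ * L) ^ 2 * u ^ 2 + 2 * ((γ * L) ^ 2 * (1 - a - 0) ^ 2) * r ^ 2 := by ring
      _ ≤ 2 * (1 / 10) * u ^ 2 + 2 * (γ * α / 8) * r ^ 2 := by gcongr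
      _ ≤ _ := by nlinarith [sq_nonneg w]
  · have hs := hac2 hc
    have h1 : a * u + c * d + (1 - a - c) * r ≤ u + w := by
      have : 1 - a - c = 0 := by linarith
      rw [this]
      obtain rfl : a = 1 - c := by linarith
      nlinarith
    have h0 : 0 ≤ a * u + c * d + (1 - a - c) * r := by
      have : 0 ≤ 1 - a - c := by linarith
      positivity
    calc _ ≤ (γ * L) ^ 2 * (u + w) ^ 2 := by gcongr
      _ ≤ 1 / 10 * (u + w) ^ 2 := by gcongr
      _ ≤ 1 / 5 * u ^ 2 + 1 / 4 * w ^ 2 := by nlinarith [sq_nonneg (u - w), sq_nonneg w]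
      _ ≤ _ := by nlinarith [mul_nonneg hα (sq_nonneg r)]

/-- Adding the three-point inequalities of the two prox steps cancels `D(x', x)`. What remains is
the monotonicity gain at `y` minus the error of the signal as a prediction of `F y`. Young's
inequality and `sq_error_le` absorb that error into the strong-convexity terms. -/
lemma energy_step (hN : ∀ x, N x = 0 → x = 0) (hreg : IsBregmanRegularizer X N h g)
    (hseg : ∀ x ∈ proxDomain X h, ∀ q ∈ X, ∀ l ∈ Ico (0 : ℝ) 1, x + l • (q - x) ∈ proxDomain X h)
    {xs : Fin n → ℝ} (hvi : IsVISolution X F xs) (hL : 0 < L) (hF : LipschitzField X N F L)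
    {a c γ : ℝ} (hac : AdmissibleSignal a c) (hγ : 0 < γ) (hγL : γ * L ≤ 5 / 16)
    (hγα : γ * (1 - a - c) ^ 2 ≤ α / (8 * L ^ 2)) {x x' y y' : Fin n → ℝ} (hy' : y' ∈ X)
    (hlead : IsProx X h g x (-(γ • (a • F x + c • F y'))) y)
    (hnext : IsProx X h g x (-(γ • F y)) x')
    (hy : α * N (y - xs) ^ 2 ≤ (F y - F xs) ⬝ᵥ (y - xs)) :
    bregDiv h g xs x' + 1 / 4 * N (x' - y) ^ 2 ≤
      bregDiv h g xs x + 1 / 4 * N (x - y') ^ 2 - 3 / 4 * (γ * α) * N (y - xs) ^ 2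
        - 3 / 10 * N (y - x) ^ 2 := by
  have hx := proxDomain_subset hlead.1
  have E1 := hnext.bregDiv_le hreg hseg hvi.1
  have E2 := hlead.bregDiv_le hreg hseg hnext.2.1
  have E3 := hreg.half_sq_le_bregDiv hlead.mem_proxDomain hnext.2.1
  have E4 := hreg.half_sq_le_bregDiv hlead.1 hlead.2.1
  have V1 := hvi.2 y hlead.2.1
  have V2 := hvi.2 x' hnext.2.1
  have P1 := hF.dotProduct_le hN hx hlead.2.1 (y - x')
  have P2 := hF.dotProduct_le hN hy' hlead.2.1 (y - x')
  have P3 := hF.dotProduct_le hN hvi.1 hlead.2.1 (y - x')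
  rw [map_sub_rev N y x'] at P1 P2 P3
  have htri : N (y - y') ≤ N (y - x) + N (x - y') := by
    simpa using map_add_le_add N (y - x) (x - y')
  have hsq := sq_error_le hL hγ hγL hac hγα (apply_nonneg N (y - x)) (apply_nonneg N (y - y'))
    (apply_nonneg N (y - xs)) (apply_nonneg N (x - y')) htri
  obtain ⟨⟨ha0, ha1⟩, ⟨hc0, hc1⟩, hac1, -⟩ := hac
  have he0 : 0 ≤ 1 - a - c := by linarith
  -- The weight `1 - a - c` missing from the signal is assigned to `F xs`; the leftover terms are
  -- then nonnegative by the variational inequality at `y` and at `x'`.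
  have hid : (-(γ • F y)) ⬝ᵥ (xs - x') + (-(γ • (a • F x + c • F y'))) ⬝ᵥ (x' - y) =
      γ * ((F y - F xs) ⬝ᵥ (y - xs)) - γ * (a * ((F y - F x) ⬝ᵥ (y - x')) +
        c * ((F y - F y') ⬝ᵥ (y - x')) + (1 - a - c) * ((F y - F xs) ⬝ᵥ (y - x')))
      + γ * (a + c) * (F xs ⬝ᵥ (y - xs)) + γ * (1 - a - c) * (F xs ⬝ᵥ (x' - xs)) := by
    simp only [neg_dotProduct, smul_dotProduct, add_dotProduct, sub_dotProduct, dotProduct_sub,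
      smul_eq_mul]
    ring
  have hΔ : a * ((F y - F x) ⬝ᵥ (y - x')) + c * ((F y - F y') ⬝ᵥ (y - x')) +
      (1 - a - c) * ((F y - F xs) ⬝ᵥ (y - x')) ≤
      L * (a * N (y - x) + c * N (y - y') + (1 - a - c) * N (y - xs)) * N (x' - y) := by
    calc _ ≤ a * (L * N (y - x) * N (x' - y)) + c * (L * N (y - y') * N (x' - y)) +
          (1 - a - c) * (L * N (y - xs) * N (x' - y)) := by gcongr
      _ = _ := by ring
  have hΔ' := mul_le_mul_of_nonneg_left hΔ hγ.le
  have hV1 : 0 ≤ γ * (a + c) * (F xs ⬝ᵥ (y - xs)) := by positivity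
  have hV2 : 0 ≤ γ * (1 - a - c) * (F xs ⬝ᵥ (x' - xs)) := by positivity
  have hyγ := mul_le_mul_of_nonneg_left hy hγ.le
  have hyoung := sq_nonneg (γ * L * (a * N (y - x) + c * N (y - y') + (1 - a - c) * N (y - xs))
    - 1 / 2 * N (x' - y))
  linarith

/-- The leading state stays in a ball around the solution. -/
lemma lead_mem_ball (hN : ∀ x, N x = 0 → x = 0) (hreg : IsBregmanRegularizer X N h g)
    (hseg : ∀ x ∈ proxDomain X h, ∀ q ∈ X, ∀ l ∈ Ico (0 : ℝ) 1, x + l • (q - x) ∈ proxDomain X h)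
    {xs : Fin n → ℝ} (hvi : IsVISolution X F xs) (hL : 0 < L) (hF : LipschitzField X N F L)
    {a c γ : ℝ} (hac : AdmissibleSignal a c) (hγ : 0 < γ) (hγL : γ * L ≤ 5 / 16)
    {x y y' : Fin n → ℝ} (hy' : y' ∈ X)
    (hlead : IsProx X h g x (-(γ • (a • F x + c • F y'))) y) {r : ℝ} (hr : 0 < r)
    (hx : bregDiv h g xs x ≤ r ^ 2 / 20) (hyr : N (y' - xs) ≤ r) : N (y - xs) ≤ r := by
  have hxX := proxDomain_subset hlead.1
  have E1 := hlead.bregDiv_le hreg hseg hvi.1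
  have E3 := hreg.half_sq_le_bregDiv hlead.mem_proxDomain hvi.1
  have E4 := hreg.half_sq_le_bregDiv hlead.1 hlead.2.1
  have E5 := hreg.half_sq_le_bregDiv hlead.1 hvi.1
  have V1 := hvi.2 y hlead.2.1
  have P1 := hF.dotProduct_le hN hvi.1 hxX (xs - y)
  have P2 := hF.dotProduct_le hN hvi.1 hy' (xs - y)
  rw [map_sub_rev N xs y] at P1 P2 E3
  rw [map_sub_rev N xs x] at E5
  obtain ⟨⟨ha0, ha1⟩, ⟨hc0, hc1⟩, hac1, -⟩ := hac
  have hid : -((-(γ • (a • F x + c • F y'))) ⬝ᵥ (xs - y)) =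
      γ * (a * ((F x - F xs) ⬝ᵥ (xs - y)) + c * ((F y' - F xs) ⬝ᵥ (xs - y))) -
        γ * (a + c) * (F xs ⬝ᵥ (y - xs)) := by
    simp only [neg_dotProduct, smul_dotProduct, add_dotProduct, sub_dotProduct, dotProduct_sub,
      smul_eq_mul]
    ring
  have hxr : N (x - xs) ≤ r := by
    refine abs_le_of_sq_le_sq' ?_ hr.le |>.2
    nlinarith
  have hV1 : 0 ≤ γ * (a + c) * (F xs ⬝ᵥ (y - xs)) := by positivity
  have hΔ : a * ((F x - F xs) ⬝ᵥ (xs - y)) + c * ((F y' - F xs) ⬝ᵥ (xs - y)) ≤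
      L * r * N (y - xs) := by
    have hNy := apply_nonneg N (y - xs)
    calc _ ≤ a * (L * N (x - xs) * N (y - xs)) + c * (L * N (y' - xs) * N (y - xs)) := by gcongr
      _ ≤ a * (L * r * N (y - xs)) + c * (L * r * N (y - xs)) := by gcongr
      _ = (a + c) * (L * r * N (y - xs)) := by ring
      _ ≤ 1 * (L * r * N (y - xs)) := by gcongr
      _ = _ := one_mul _
  have hΔ' : γ * (a * ((F x - F xs) ⬝ᵥ (xs - y)) + c * ((F y' - F xs) ⬝ᵥ (xs - y))) ≤
      5 / 16 * (r * N (y - xs)) := by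
    calc _ ≤ γ * (L * r * N (y - xs)) := by gcongr
      _ = (γ * L) * (r * N (y - xs)) := by ring
      _ ≤ _ := by
        have := apply_nonneg N (y - xs)
        gcongr
  -- Outside the ball, `N² / 2 - (5 / 16) * r * N` exceeds `(3 / 16) * r²`, whereas the prox
  -- inequality allows at most `r² / 20`.
  by_contra hcon
  push Not at hcon
  nlinarith [sq_nonneg (N (y - x))]

lemma run_tendsto (hN : ∀ x, N x = 0 → x = 0) (hreg : IsBregmanRegularizer X N h g)
    (hseg : ∀ x ∈ proxDomain X h, ∀ q ∈ X, ∀ l ∈ Ico (0 : ℝ) 1, x + l • (q - x) ∈ proxDomain X h)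
    {xs : Fin n → ℝ} (hvi : IsVISolution X F xs) (hL : 0 < L) (hF : LipschitzField X N F L)
    (hα : 0 < α) {r : ℝ} (hr : 0 < r)
    (hmono : ∀ x ∈ X, N (x - xs) ≤ r → α * N (x - xs) ^ 2 ≤ (F x - F xs) ⬝ᵥ (x - xs))
    {a c γ : ℝ} (hac : AdmissibleSignal a c) (hγ : 0 < γ) (hγL : γ * L ≤ 5 / 16)
    (hγα : γ * (1 - a - c) ^ 2 ≤ α / (8 * L ^ 2)) {x y : ℕ → Fin n → ℝ}
    (hrun : IsBPMRun X h g F a c γ x y) (hx1 : bregDiv h g xs (x 1) ≤ r ^ 2 / 20) :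
    Tendsto x atTop (𝓝 xs) ∧ Tendsto y atTop (𝓝 xs) := by
  have hlead : ∀ t, IsProx X h g (x (t + 1)) (-(γ • (a • F (x (t + 1)) + c • F (y t))))
      (y (t + 1)) := fun t => by simpa using hrun.lead (t + 1) (by omega)
  have hnext : ∀ t, IsProx X h g (x (t + 1)) (-(γ • F (y (t + 1)))) (x (t + 2)) :=
    fun t => hrun.next (t + 1) (by omega)
  have hyX : ∀ t, y t ∈ X := by
    rintro (_ | t)
    · rw [hrun.init]
      exact proxDomain_subset (hlead 0).1
    · exact (hlead t).2.1
  -- Indices are shifted so that the run starts at `t = 0`, where the second term vanishes because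
  -- `y 0 = x 1`.
  set Φ : ℕ → ℝ := fun t => bregDiv h g xs (x (t + 1)) + 1 / 4 * N (x (t + 1) - y t) ^ 2 with hΦ
  have hstep : ∀ t, N (y (t + 1) - xs) ≤ r → Φ (t + 1) ≤
      Φ t - 3 / 4 * (γ * α) * N (y (t + 1) - xs) ^ 2 - 3 / 10 * N (y (t + 1) - x (t + 1)) ^ 2 :=
    fun t ht => energy_step hN hreg hseg hvi hL hF hac hγ hγL hγα (hyX t) (hlead t) (hnext t)
      (hmono _ (hyX _) ht)
  have hγα0 : 0 < γ * α := mul_pos hγ hα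
  have hinv : ∀ t, Φ t ≤ r ^ 2 / 20 ∧ N (y t - xs) ≤ r := by
    intro t
    induction t with
    | zero =>
      refine ⟨by simpa [hΦ, hrun.init] using hx1, ?_⟩
      rw [hrun.init]
      have := (hreg.half_sq_le_bregDiv (hlead 0).1 hvi.1).trans hx1
      rw [map_sub_rev] at this
      refine abs_le_of_sq_le_sq' ?_ hr.le |>.2
      nlinarith
    | succ t ih =>
      have hb : N (y (t + 1) - xs) ≤ r := by
        refine lead_mem_ball hN hreg hseg hvi hL hF hac hγ hγL (hyX t) (hlead t) hr ?_ ih.2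
        have := ih.1
        simp only [hΦ] at this
        nlinarith [sq_nonneg (N (x (t + 1) - y t))]
      refine ⟨?_, hb⟩
      nlinarith [hstep t hb, ih.1, sq_nonneg (N (y (t + 1) - x (t + 1))),
        mul_nonneg hγα0.le (sq_nonneg (N (y (t + 1) - xs)))]
  have hdec : ∀ t, Φ (t + 1) ≤
      Φ t - 3 / 4 * (γ * α) * N (y (t + 1) - xs) ^ 2 - 3 / 10 * N (y (t + 1) - x (t + 1)) ^ 2 :=
    fun t => hstep t (hinv (t + 1)).2
  have hanti : Antitone Φ := antitone_nat_of_succ_le fun t => by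
    nlinarith [hdec t, sq_nonneg (N (y (t + 1) - x (t + 1))),
        mul_nonneg hγα0.le (sq_nonneg (N (y (t + 1) - xs)))]
  have hΦ0 : ∀ t, 0 ≤ Φ t := fun t => by
    have := hreg.half_sq_le_bregDiv (hlead t).1 hvi.1
    have := sq_nonneg (N (xs - x (t + 1)))
    have := sq_nonneg (N (x (t + 1) - y t))
    simp only [hΦ]
    linarith
  have hlim := tendsto_atTop_ciInf hanti ⟨0, by rintro _ ⟨t, rfl⟩; exact hΦ0 t⟩
  have hdiff : Tendsto (fun t => Φ t - Φ (t + 1)) atTop (𝓝 0) := by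
    simpa using hlim.sub ((tendsto_add_atTop_iff_nat 1).2 hlim)
  have hsqrt : ∀ (f : ℕ → ℝ) (k : ℝ), 0 < k → (∀ t, 0 ≤ f t) →
      (∀ t, k * f t ^ 2 ≤ Φ t - Φ (t + 1)) → Tendsto f atTop (𝓝 0) := by
    intro f k hk hf hle
    have h1 : Tendsto (fun t => f t ^ 2) atTop (𝓝 0) := by
      refine squeeze_zero (fun t => sq_nonneg _) (fun t => ?_)
        (by simpa using hdiff.const_mul k⁻¹)
      rw [← div_eq_inv_mul, le_div_iff₀' hk]
      exact hle t
    have h2 := h1.sqrt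
    simpa [Real.sqrt_sq (hf _)] using h2
  have hy0 : Tendsto (fun t => N (y (t + 1) - xs)) atTop (𝓝 0) :=
    hsqrt _ (3 / 4 * (γ * α)) (by positivity) (fun t => apply_nonneg _ _) fun t => by
      nlinarith [hdec t, sq_nonneg (N (y (t + 1) - x (t + 1)))]
  have hyx0 : Tendsto (fun t => N (y (t + 1) - x (t + 1))) atTop (𝓝 0) :=
    hsqrt _ (3 / 10) (by positivity) (fun t => apply_nonneg _ _) fun t => by
      nlinarith [hdec t, mul_nonneg hγα0.le (sq_nonneg (N (y (t + 1) - xs)))]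
  have hx0 : Tendsto (fun t => N (x (t + 1) - xs)) atTop (𝓝 0) := by
    refine squeeze_zero (fun t => apply_nonneg _ _) (fun t => ?_) (by simpa using hyx0.add hy0)
    rw [map_sub_rev N (y (t + 1))]
    simpa using map_add_le_add N (x (t + 1) - y (t + 1)) (y (t + 1) - xs)
  obtain ⟨k, hk, hkN⟩ := exists_mul_norm_le_seminorm N hN
  have hconv : ∀ f : ℕ → Fin n → ℝ, Tendsto (fun t => N (f (t + 1) - xs)) atTop (𝓝 0) →
      Tendsto f atTop (𝓝 xs) := by
    intro f hf
    rw [← tendsto_add_atTop_iff_nat 1, tendsto_iff_norm_sub_tendsto_zero]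
    refine squeeze_zero (fun t => norm_nonneg _) (fun t => ?_) (by simpa using hf.const_mul k⁻¹)
    rw [← div_eq_inv_mul, le_div_iff₀' hk]
    exact hkN _
  exact ⟨hconv x hx0, hconv y hy0⟩

end Energy

/-! ### Bregman reciprocity -/

section Reciprocity

variable {m : ℕ} {A : Matrix (Fin m) (Fin n) ℝ} {b : Fin m → ℝ} {N : Seminorm ℝ (Fin n → ℝ)}
  {h : (Fin n → ℝ) → ℝ} {g : (Fin n → ℝ) → (Fin n → ℝ)} {θ : ℝ → ℝ}

/-- The reflection `2x - xs` stays in the polyhedron for `x` near `xs`: active coordinates double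
and inactive ones remain positive. The subgradient inequality at `x`, tested there, bounds `D(xs,
x)` by a second difference of `h`, which tends to zero by continuity, with no control on `g` needed.
-/
lemma eventually_bregDiv_le (hreg : IsBregmanRegularizer (polyhedron A b) N h g)
    (hd : IsDecomposable (polyhedron A b) h θ) {xs : Fin n → ℝ} (hxs : xs ∈ polyhedron A b)
    {δ : ℝ} (hδ : 0 < δ) :
    ∀ᶠ x in 𝓝 xs, x ∈ proxDomain (polyhedron A b) h → bregDiv h g xs x ≤ δ := by
  have hcont := (hd.continuousOn_regularizer polyhedron_nonneg xs hxs).tendsto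
  have hrefl : Tendsto (fun x : Fin n → ℝ => x + (x - xs)) (𝓝[polyhedron A b] xs) (𝓝 xs) := by
    have : Tendsto (fun x : Fin n → ℝ => x + (x - xs)) (𝓝 xs) (𝓝 (xs + (xs - xs))) :=
      Continuous.tendsto (by fun_prop) xs
    rw [sub_self, add_zero] at this
    exact this.mono_left nhdsWithin_le_nhds
  have hmem : ∀ᶠ x in 𝓝[polyhedron A b] xs, x + (x - xs) ∈ polyhedron A b := by
    have h1 : ∀ j, ∀ᶠ x in 𝓝[polyhedron A b] xs, 0 ≤ (x + (x - xs)) j := by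
      intro j
      rcases (hxs.1 j).eq_or_lt with h0 | h0
      · filter_upwards [self_mem_nhdsWithin] with x hx
        have := hx.1 j
        simp only [Pi.add_apply, Pi.sub_apply, ← h0]
        linarith
      · filter_upwards [(tendsto_pi_nhds.1 hrefl j).eventually (lt_mem_nhds h0)] with x hx
          using hx.le
    filter_upwards [eventually_all.2 h1, self_mem_nhdsWithin] with x hx hxX
    exact ⟨hx, by rw [Matrix.mulVec_add, mulVec_sub_eq_zero hxs hxX, add_zero, hxX.2]⟩
  have hlim : Tendsto (fun x => h xs - 2 * h x + h (x + (x - xs))) (𝓝[polyhedron A b] xs)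
      (𝓝 (h xs - 2 * h xs + h xs)) :=
    (tendsto_const_nhds.sub (hcont.const_mul 2)).add
      (hcont.comp (tendsto_nhdsWithin_iff.2 ⟨hrefl, hmem⟩))
  have hev := hlim.eventually (gt_mem_nhds (show h xs - 2 * h xs + h xs < δ by linarith))
  filter_upwards [eventually_nhdsWithin_iff.1 (hev.and hmem)] with x hx hxp
  obtain ⟨h1, h2⟩ := hx (proxDomain_subset hxp)
  have h3 := (hreg.selection_mem x hxp).2 _ h2
  simp only [bregDiv, dotProduct_sub, dotProduct_add] at h3 ⊢
  linarith

/-- At a positive point both `w` and `-w` are feasible, so the subgradient inequality is a two-sided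
minimum along the line and the derivative vanishes. Only directions in the kernel of `A` can be
tested. -/
lemma selection_dotProduct (hreg : IsBregmanRegularizer (polyhedron A b) N h g)
    (hd : IsDecomposable (polyhedron A b) h θ) {x w : Fin n → ℝ} (hx : x ∈ polyhedron A b)
    (hpos : ∀ j, 0 < x j) (hw : A *ᵥ w = 0) :
    g x ⬝ᵥ w = ∑ j, deriv θ (x j) * w j := by
  have hsub := hreg.selection_mem x (mem_proxDomain_of_pos hd hx hpos)
  set f : ℝ → ℝ := fun ε => ∑ j, θ (x j + ε * w j) - ε * (g x ⬝ᵥ w) with hf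
  have hder : HasDerivAt f (∑ j, deriv θ (x j) * w j - g x ⬝ᵥ w) 0 := by
    refine HasDerivAt.sub (HasDerivAt.fun_sum fun j _ => ?_) ?_
    · have h1 : HasDerivAt (fun ε : ℝ => x j + ε * w j) (w j) 0 := by
        simpa using ((hasDerivAt_id (0 : ℝ)).mul_const (w j)).const_add (x j)
      have h2 : HasDerivAt θ (deriv θ (x j)) (x j + 0 * w j) := by
        simpa using (hd.differentiableAt (hpos j)).hasDerivAt
      exact h2.comp 0 h1
    · simpa using (hasDerivAt_id (0 : ℝ)).mul_const (g x ⬝ᵥ w)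
  have hmin : IsLocalMin f 0 := by
    have h1 : ∀ j, ∀ᶠ ε : ℝ in 𝓝 0, 0 < x j + ε * w j := fun j => by
      have : Tendsto (fun ε : ℝ => x j + ε * w j) (𝓝 0) (𝓝 (x j + 0 * w j)) :=
        Continuous.tendsto (by fun_prop) 0
      exact this.eventually (lt_mem_nhds (by simpa using hpos j))
    filter_upwards [eventually_all.2 h1] with ε hε
    have hmem : x + ε • w ∈ polyhedron A b := ⟨fun j => by simpa using (hε j).le, by
      rw [Matrix.mulVec_add, Matrix.mulVec_smul, hw, smul_zero, add_zero, hx.2]⟩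
    have := hsub.2 _ hmem
    rw [hd.eq_sum x hx, hd.eq_sum _ hmem, add_sub_cancel_left, dotProduct_smul, smul_eq_mul]
      at this
    simp only [hf, zero_mul, add_zero, sub_zero]
    simp only [Pi.add_apply, Pi.smul_apply, smul_eq_mul] at this
    linarith
  have := hmin.hasDerivAt_eq_zero hder
  linarith

end Reciprocity

/-! ### Feasible directions with prescribed support -/

section Directions

lemma exists_ratio_bound (w : Finset (Fin n) → Fin n → ℝ) :
    ∃ κ : ℝ, 0 < κ ∧ ∀ σ i j, 0 < w σ i → 0 < w σ j → κ * w σ i ≤ w σ j := by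
  have h1 : ∀ σ i j, ∀ᶠ κ : ℝ in 𝓝[>] 0, 0 < w σ i → 0 < w σ j → κ * w σ i ≤ w σ j := by
    intro σ i j
    by_cases hj : 0 < w σ j
    · have : Tendsto (fun κ : ℝ => κ * w σ i) (𝓝[>] 0) (𝓝 (0 * w σ i)) :=
        tendsto_nhdsWithin_of_tendsto_nhds (Continuous.tendsto (by fun_prop) 0)
      filter_upwards [this.eventually (gt_mem_nhds (by simpa using hj))] with κ hκ _ _ using hκ.le
    · exact Eventually.of_forall fun κ _ h => absurd h hj
  have h2 := eventually_all.2 fun σ => eventually_all.2 fun i => eventually_all.2 (h1 σ i)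
  obtain ⟨κ, hκ, hκ0⟩ := (h2.and self_mem_nhdsWithin).exists
  exact ⟨κ, hκ0, hκ⟩

/-- If each support on `S` of a vector of `K` that is nonnegative on `S` is represented by a
vector `w σ` of `K`, then a vector `d` of `K` that is nonnegative on `S` with `d i > 0` is
bounded below, up to a constant and on `S`, by `d i` on the support of a representative that
contains `i`. -/
lemma exists_direction_le (S : Finset (Fin n)) (K : Submodule ℝ (Fin n → ℝ))
    (w : Finset (Fin n) → Fin n → ℝ)
    (hw : ∀ d ∈ K, (∀ j ∈ S, 0 ≤ d j) → w (S.filter (0 < d ·)) ∈ K ∧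
      ∀ j ∈ S, (0 < d j → 0 < w (S.filter (0 < d ·)) j) ∧
        (d j = 0 → w (S.filter (0 < d ·)) j = 0))
    {κ : ℝ} (hκ0 : 0 < κ)
    (hκ : ∀ σ i j, 0 < w σ i → 0 < w σ j → κ * w σ i ≤ w σ j) (k : ℕ) :
    ∀ d ∈ K, (∀ j ∈ S, 0 ≤ d j) → (S.filter (0 < d ·)).card ≤ k → ∀ i ∈ S, 0 < d i →
      ∃ σ, w σ ∈ K ∧ (∀ j ∈ S, 0 ≤ w σ j) ∧ 0 < w σ i ∧
        ∀ j ∈ S, 0 < w σ j → κ / 2 ^ k * d i ≤ d j := by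
  induction k with
  | zero =>
    intro d _ _ hcard i hi hdi
    have : i ∈ S.filter (0 < d ·) := Finset.mem_filter.2 ⟨hi, hdi⟩
    rw [Finset.card_eq_zero.1 (Nat.le_zero.1 hcard)] at this
    simp at this
  | succ k ih =>
    intro d hdK hd hcard i hi hdi
    obtain ⟨hwK, hwS⟩ := hw d hdK hd
    set σ := S.filter (0 < d ·) with hσ
    have hiσ : i ∈ σ := Finset.mem_filter.2 ⟨hi, hdi⟩
    have hwi := (hwS i hi).1 hdi
    have hwnn : ∀ j ∈ S, 0 ≤ w σ j := fun j hj => by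
      rcases (hd j hj).eq_or_lt with h | h
      · exact ((hwS j hj).2 h.symm).ge
      · exact ((hwS j hj).1 h).le
    have hdpos : ∀ j ∈ S, 0 < w σ j → 0 < d j := fun j hj hwj => by
      rcases (hd j hj).eq_or_lt with h | h
      · exact absurd ((hwS j hj).2 h.symm) hwj.ne'
      · exact h
    -- The minimal ratio `c` is the largest multiple of `w σ` that can be subtracted while staying
    -- nonnegative on `S`; it annihilates coordinate `j₀`.
    obtain ⟨j₀, hj₀, hmin⟩ := σ.exists_min_image (fun j => d j / w σ j) ⟨i, hiσ⟩
    obtain ⟨hj₀S, hdj₀⟩ := Finset.mem_filter.1 hj₀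
    have hwj₀ := (hwS j₀ hj₀S).1 hdj₀
    set c := d j₀ / w σ j₀ with hc
    have hc0 : 0 < c := div_pos hdj₀ hwj₀
    have hcw : ∀ j ∈ S, c * w σ j ≤ d j := fun j hj => by
      rcases (hwnn j hj).eq_or_lt with h | h
      · rw [← h, mul_zero]
        exact hd j hj
      · have := hmin j (Finset.mem_filter.2 ⟨hj, hdpos j hj h⟩)
        rwa [le_div_iff₀ h] at this
    have hpow : κ / 2 ^ (k + 1) = κ / 2 ^ k / 2 := by rw [pow_succ, div_div]
    -- Either `c • w σ` carries half of `d i`, and `σ` serves, or the remainder keeps half of `d i`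
    -- on a strictly smaller support. Each round costs a factor `2`.
    by_cases hhalf : d i / 2 ≤ c * w σ i
    · refine ⟨σ, hwK, hwnn, hwi, fun j hj hwj => ?_⟩
      have h1 : κ / 2 ^ k ≤ κ := div_le_self hκ0.le (one_le_pow₀ (by norm_num))
      calc κ / 2 ^ (k + 1) * d i = κ / 2 ^ k * (d i / 2) := by rw [hpow]; ring
        _ ≤ κ * (c * w σ i) := by gcongr
        _ = c * (κ * w σ i) := by ring
        _ ≤ c * w σ j := by
          have := hκ σ i j hwi hwj
          gcongr
        _ ≤ d j := hcw j hj
    · push Not at hhalf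
      have hd'nn : ∀ j ∈ S, 0 ≤ (d - c • w σ) j := fun j hj => by
        simpa using hcw j hj
      have hd'le : ∀ j ∈ S, (d - c • w σ) j ≤ d j := fun j hj => by
        have := mul_nonneg hc0.le (hwnn j hj)
        simpa using this
      have hcard' : (S.filter (0 < (d - c • w σ) ·)).card ≤ k := by
        have hss : S.filter (0 < (d - c • w σ) ·) ⊆ σ.erase j₀ := by
          intro j hj
          obtain ⟨hjS, hj0⟩ := Finset.mem_filter.1 hj
          refine Finset.mem_erase.2 ⟨?_, Finset.mem_filter.2 ⟨hjS, hj0.trans_le (hd'le j hjS)⟩⟩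
          rintro rfl
          have : (d - c • w σ) j = 0 := by
            simp [hc, div_mul_cancel₀ _ hwj₀.ne']
          exact hj0.ne' this
        have := Finset.card_le_card hss
        rw [Finset.card_erase_of_mem hj₀] at this
        omega
      have hd'i : d i / 2 ≤ (d - c • w σ) i := by
        simp only [Pi.sub_apply, Pi.smul_apply, smul_eq_mul]
        linarith
      obtain ⟨τ, h1, h2, h3, h4⟩ := ih _ (K.sub_mem hdK (K.smul_mem c hwK)) hd'nn hcard' i hi
        (by linarith)
      refine ⟨τ, h1, h2, h3, fun j hj hwj => ?_⟩
      calc κ / 2 ^ (k + 1) * d i = κ / 2 ^ k * (d i / 2) := by rw [hpow]; ring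
        _ ≤ κ / 2 ^ k * (d - c • w σ) i := by gcongr
        _ ≤ (d - c • w σ) j := h4 j hj hwj
        _ ≤ d j := hd'le j hj

open Classical in
/-- A vector `x - xs` with `x ∈ X` whose support on the active set at `xs` is `σ`, if there
is one. -/
noncomputable def faceDirection (X : Set (Fin n → ℝ)) (xs : Fin n → ℝ) (σ : Finset (Fin n)) : Fin n → ℝ :=
  if hσ : ∃ x ∈ X, ∀ j ∈ activeCoords xs, 0 < x j ↔ j ∈ σ then hσ.choose - xs else 0

/-- The point `xs + ε • d`, for small `ε > 0`, lies in the polyhedron and has the required support,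
so the choice in `faceDirection` is not the default `0`. -/
lemma faceDirection_spec {m : ℕ} {A : Matrix (Fin m) (Fin n) ℝ} {b : Fin m → ℝ} {xs d : Fin n → ℝ}
    (hxs : xs ∈ polyhedron A b) (hd : A *ᵥ d = 0) (hdn : ∀ j ∈ activeCoords xs, 0 ≤ d j) :
    A *ᵥ faceDirection (polyhedron A b) xs ((activeCoords xs).filter (0 < d ·)) = 0 ∧
      ∀ j ∈ activeCoords xs,
        (0 < d j → 0 < faceDirection (polyhedron A b) xs ((activeCoords xs).filter (0 < d ·)) j) ∧
        (d j = 0 →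
          faceDirection (polyhedron A b) xs ((activeCoords xs).filter (0 < d ·)) j = 0) := by
  set σ := (activeCoords xs).filter (0 < d ·) with hσ
  have hact : ∀ j ∈ activeCoords xs, xs j = 0 := fun j hj => (Finset.mem_filter.1 hj).2
  have hex : ∃ x ∈ polyhedron A b, ∀ j ∈ activeCoords xs, 0 < x j ↔ j ∈ σ := by
    obtain ⟨ε, hε, hε0⟩ := ((eventually_add_smul_mem_polyhedron hxs hd fun j hj =>
      hdn j (Finset.mem_filter.2 ⟨Finset.mem_univ j, hj⟩)).and self_mem_nhdsWithin).exists
    refine ⟨_, hε, fun j hj => ?_⟩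
    have hε0' : 0 < ε := hε0
    rw [hσ, Finset.mem_filter]
    simp [hact j hj, hj, hε0']
  rw [faceDirection, dif_pos hex]
  obtain ⟨h1, h2⟩ := hex.choose_spec
  refine ⟨mulVec_sub_eq_zero hxs h1, fun j hj => ⟨fun h => ?_, fun h => ?_⟩⟩
  · rw [Pi.sub_apply, hact j hj, sub_zero, h2 j hj]
    exact Finset.mem_filter.2 ⟨hj, h⟩
  · rw [Pi.sub_apply, hact j hj, sub_zero]
    refine le_antisymm (not_lt.1 fun h' => ?_) (h1.1 j)
    exact (Finset.mem_filter.1 ((h2 j hj).1 h')).2.ne' h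

end Directions

/-! ### Slackness and sharpness -/

section Slackness

variable {m : ℕ} {A : Matrix (Fin m) (Fin n) ℝ} {xs s v w : Fin n → ℝ}

lemma IsSlackness.dotProduct_eq (hs : IsSlackness A xs v s) (hw : A *ᵥ w = 0) :
    v ⬝ᵥ w = ∑ j ∈ activeCoords xs, s j * w j := by
  have hrow : ∀ u ∈ Submodule.span ℝ (Set.range fun k : Fin m => A k), u ⬝ᵥ w = 0 := by
    intro u hu
    induction hu using Submodule.span_induction with
    | mem u hu =>
      obtain ⟨k, rfl⟩ := hu
      exact congrFun hw k
    | zero => exact zero_dotProduct w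
    | add u u' _ _ h1 h2 => rw [add_dotProduct, h1, h2, add_zero]
    | smul r u _ h1 => rw [smul_dotProduct, h1, smul_zero]
  have h1 := hrow _ hs.2
  rw [sub_dotProduct, sum_dotProduct, sub_eq_zero] at h1
  rw [h1]
  exact Finset.sum_congr rfl fun j _ => by simp

lemma sharpness_le {i : Fin n} (hi : i ∈ sharpCoords xs s) : sharpness xs s ≤ s i :=
  csInf_le ((Finset.finite_toSet _).image s).bddBelow ⟨i, hi, rfl⟩

lemma sharpness_pos {i : Fin n} (hi : i ∈ sharpCoords xs s) : 0 < sharpness xs s := by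
  obtain ⟨j, hj, hjs⟩ : sharpness xs s ∈ s '' (sharpCoords xs s : Set (Fin n)) :=
    Set.Nonempty.csInf_mem ⟨s i, i, hi, rfl⟩ ((Finset.finite_toSet _).image s)
  rw [← hjs]
  exact (Finset.mem_filter.1 hj).2

lemma effSharpness_pos {ρ : ℝ} (hρ : 1 ≤ ρ) {i : Fin n} (hi : i ∈ sharpCoords xs s) :
    0 < effSharpness ρ xs s := by
  have := sharpness_pos hi
  rw [effSharpness]
  split_ifs <;> positivity

/-- Without flat coordinates every active `s j` is at least the sharpness. Otherwise only the term
at `i` is kept, and the loss is the factor `ρ` by which the sum may exceed `w i`. -/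
lemma IsSlackness.effSharpness_mul_sum_le (hs : IsSlackness A xs v s) {ρ : ℝ} (hρ : 1 ≤ ρ)
    (hw : ∀ j ∈ activeCoords xs, 0 ≤ w j) {i : Fin n} (hi : i ∈ sharpCoords xs s)
    (hsum : ∑ j ∈ activeCoords xs, w j ≤ ρ * w i) :
    effSharpness ρ xs s * ∑ j ∈ activeCoords xs, w j ≤ ∑ j ∈ activeCoords xs, s j * w j := by
  have hμ := sharpness_pos hi
  have hia := (Finset.mem_filter.1 hi).1
  rw [effSharpness]
  split_ifs with hflat
  · rw [Finset.mul_sum]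
    refine Finset.sum_le_sum fun j hj => mul_le_mul_of_nonneg_right ?_ (hw j hj)
    refine sharpness_le (Finset.mem_filter.2 ⟨hj, lt_of_le_of_ne (hs.1 j hj) fun h => ?_⟩)
    have : j ∈ flatCoords xs s := Finset.mem_filter.2 ⟨hj, h.symm⟩
    simp [hflat] at this
  · have hρ0 : 0 < ρ := by linarith
    have hwi := hw i hia
    calc sharpness xs s / ρ * ∑ j ∈ activeCoords xs, w j ≤ sharpness xs s / ρ * (ρ * w i) := by
          gcongr
      _ = sharpness xs s * w i := by field_simp
      _ ≤ s i * w i := by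
          have := sharpness_le hi
          gcongr
      _ ≤ _ := Finset.single_le_sum (f := fun j => s j * w j)
          (fun j hj => mul_nonneg (hs.1 j hj) (hw j hj)) hia

end Slackness

/-! ### From kernels to rates -/

section Rates

variable {θ : ℝ → ℝ} {u τ : ℕ → ℝ} {κ C : ℝ}

lemma exists_lt_of_bot_lt_liminf {f : ℝ → ℝ}
    (hf : (⊥ : EReal) < liminf (fun z : ℝ => ((f z : ℝ) : EReal)) (𝓝[>] 0)) :
    ∃ M : ℝ, ∀ᶠ z in 𝓝[>] 0, M < f z := by
  obtain ⟨M, -, hM⟩ := EReal.lt_iff_exists_real_btwn.1 hf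
  exact ⟨M, (eventually_lt_of_lt_liminf hM).mono fun z hz => EReal.coe_lt_coe_iff.1 hz⟩

lemma EntropyLike.isBigO (hθ : EntropyLike θ) (hκ : 0 < κ) (hu : ∀ᶠ t in atTop, 0 < u t)
    (hu0 : Tendsto u atTop (𝓝 0)) (hle : ∀ᶠ t in atTop, deriv θ (κ * u t) ≤ C - τ t) :
    u =O[atTop] fun t => Real.exp (-τ t) := by
  obtain ⟨M, hM⟩ := exists_lt_of_bot_lt_liminf hθ
  have hlim : Tendsto (fun t => κ * u t) atTop (𝓝[>] 0) :=
    tendsto_nhdsWithin_iff.2 ⟨by simpa using hu0.const_mul κ, hu.mono fun t ht => mul_pos hκ ht⟩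
  refine IsBigO.of_bound (Real.exp (C - M) / κ) ?_
  filter_upwards [hlim.eventually hM, hu, hle] with t h1 h2 h3
  rw [Real.norm_of_nonneg h2.le, Real.norm_of_nonneg (Real.exp_pos _).le, div_mul_eq_mul_div,
    le_div_iff₀' hκ, ← Real.exp_add, ← Real.log_le_iff_le_exp (mul_pos hκ h2)]
  linarith

lemma PowerLike.isBigO {q : ℝ} (hq : 0 < q) (hθ : PowerLike q θ) (hκ : 0 < κ)
    (hu : ∀ᶠ t in atTop, 0 < u t) (hu0 : Tendsto u atTop (𝓝 0))
    (hle : ∀ᶠ t in atTop, deriv θ (κ * u t) ≤ C - τ t) (hτ : Tendsto τ atTop atTop) :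
    u =O[atTop] fun t => τ t ^ (-(1 / q)) := by
  obtain ⟨M, hM⟩ := exists_lt_of_bot_lt_liminf hθ
  have hlim : Tendsto (fun t => κ * u t) atTop (𝓝[>] 0) :=
    tendsto_nhdsWithin_iff.2 ⟨by simpa using hu0.const_mul κ, hu.mono fun t ht => mul_pos hκ ht⟩
  refine IsBigO.of_bound ((2 * |M|) ^ (1 / q) / κ) ?_
  filter_upwards [hlim.eventually hM, hu, hle, hτ.eventually_ge_atTop (2 * |C|),
    hτ.eventually_gt_atTop 0] with t h1 h2 h3 h4 h5
  have hz : 0 < κ * u t := mul_pos hκ h2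
  have hzq : 0 < (κ * u t) ^ q := Real.rpow_pos_of_pos hz q
  rw [Real.norm_of_nonneg h2.le, Real.norm_of_nonneg (Real.rpow_nonneg h5.le _),
    div_mul_eq_mul_div, le_div_iff₀' hκ]
  -- Half of `τ t` is given up to absorb the additive constant `C`.
  have h6 : deriv θ (κ * u t) ≤ -(τ t / 2) := by linarith [le_abs_self C]
  have h7 : (κ * u t) ^ q ≤ 2 * |M| / τ t := by
    rw [le_div_iff₀ h5]
    have := mul_le_mul_of_nonneg_left h6 hzq.le
    linarith [neg_abs_le M]
  calc κ * u t = ((κ * u t) ^ q) ^ (1 / q) := by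
        rw [← Real.rpow_mul hz.le, mul_one_div_cancel hq.ne', Real.rpow_one]
    _ ≤ (2 * |M| / τ t) ^ (1 / q) := by gcongr
    _ = _ := by
        rw [Real.div_rpow (by positivity) h5.le, Real.rpow_neg h5.le, div_eq_mul_inv]

end Rates

/-! ### Identification and decay of sharp coordinates -/

section SharpCoordinates

variable {m : ℕ} {A : Matrix (Fin m) (Fin n) ℝ} {b : Fin m → ℝ} {N : Seminorm ℝ (Fin n → ℝ)}
  {h : (Fin n → ℝ) → ℝ} {g : (Fin n → ℝ) → (Fin n → ℝ)} {θ : ℝ → ℝ}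
  {F : (Fin n → ℝ) → (Fin n → ℝ)} {xs s : Fin n → ℝ}

lemma LipschitzField.tendsto_dotProduct {X : Set (Fin n → ℝ)} {L : ℝ}
    (hF : LipschitzField X N F L) (hN : ∀ x, N x = 0 → x = 0) (hxs : xs ∈ X)
    {y : ℕ → Fin n → ℝ} (hyX : ∀ t, y t ∈ X) (hy : Tendsto y atTop (𝓝 xs)) (w : Fin n → ℝ) :
    Tendsto (fun t => F (y t) ⬝ᵥ w) atTop (𝓝 (F xs ⬝ᵥ w)) := by
  rw [tendsto_iff_norm_sub_tendsto_zero]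
  have h0 : Tendsto (fun t => N (y t - xs)) atTop (𝓝 0) := by
    have : Tendsto (fun t => N (y t - xs)) atTop (𝓝 (N (xs - xs))) :=
      ((seminorm_continuous N).tendsto _).comp (hy.sub_const xs)
    simpa using this
  refine squeeze_zero (fun t => norm_nonneg _) (fun t => ?_)
    (by simpa using (h0.const_mul L).mul_const (N w))
  rw [Real.norm_eq_abs, ← sub_dotProduct, abs_le]
  have h1 := hF.dotProduct_le hN hxs (hyX t) w
  have h2 := hF.dotProduct_le hN hxs (hyX t) (-w)
  rw [dotProduct_neg, map_neg_eq_map] at h2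
  constructor <;> linarith

/-- This is `exists_direction_le` for `d = x - xs`, which agrees with `x` on the active set;
supports have at most `n` elements, hence `2 ^ n`. -/
lemma exists_face_bound (hxs : xs ∈ polyhedron A b) {κ : ℝ} (hκ0 : 0 < κ)
    (hκ : ∀ σ i j, 0 < faceDirection (polyhedron A b) xs σ i →
      0 < faceDirection (polyhedron A b) xs σ j →
      κ * faceDirection (polyhedron A b) xs σ i ≤ faceDirection (polyhedron A b) xs σ j)
    {x : Fin n → ℝ} (hx : x ∈ polyhedron A b) {i : Fin n} (hi : i ∈ activeCoords xs)
    (hxi : 0 < x i) :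
    ∃ σ, A *ᵥ faceDirection (polyhedron A b) xs σ = 0 ∧
      (∀ j ∈ activeCoords xs, 0 ≤ faceDirection (polyhedron A b) xs σ j) ∧
      0 < faceDirection (polyhedron A b) xs σ i ∧
      ∀ j ∈ activeCoords xs, 0 < faceDirection (polyhedron A b) xs σ j →
        κ / 2 ^ n * x i ≤ x j := by
  have hact : ∀ j ∈ activeCoords xs, xs j = 0 := fun j hj => (Finset.mem_filter.1 hj).2
  have hker : ∀ d, d ∈ LinearMap.ker A.mulVecLin ↔ A *ᵥ d = 0 := fun d => by simp
  obtain ⟨σ, h1, h2, h3, h4⟩ := exists_direction_le (activeCoords xs) (LinearMap.ker A.mulVecLin)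
    (faceDirection (polyhedron A b) xs)
    (fun d hd hdn => by
      rw [hker] at hd ⊢
      exact faceDirection_spec hxs hd hdn) hκ0 hκ n (x - xs)
    ((hker _).2 (mulVec_sub_eq_zero hxs hx))
    (fun j hj => by simpa [hact j hj] using hx.1 j)
    (by simpa using Finset.card_le_univ ((activeCoords xs).filter (0 < (x - xs) ·))) i hi
    (by simpa [hact i hi] using hxi)
  refine ⟨σ, (hker _).1 h1, h2, h3, fun j hj hwj => ?_⟩
  simpa [hact j hj, hact i hi] using h4 j hj hwj

lemma IsSlackness.dotProduct_pos {v w : Fin n → ℝ} (hs : IsSlackness A xs v s)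
    (hw : A *ᵥ w = 0) (hwn : ∀ j ∈ activeCoords xs, 0 ≤ w j) {i : Fin n}
    (hi : i ∈ sharpCoords xs s) (hwi : 0 < w i) : 0 < v ⬝ᵥ w := by
  obtain ⟨hia, his⟩ := Finset.mem_filter.1 hi
  rw [hs.dotProduct_eq hw]
  exact (mul_pos his hwi).trans_le (Finset.single_le_sum (f := fun j => s j * w j)
    (fun j hj => mul_nonneg (hs.1 j hj) (hwn j hj)) hia)

lemma eventually_pos_of_notMem_activeCoords {X : Set (Fin n → ℝ)} (hX : ∀ x ∈ X, ∀ i, 0 ≤ x i)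
    (hxs : xs ∈ X) {x : ℕ → Fin n → ℝ} (hx : Tendsto x atTop (𝓝 xs)) :
    ∀ᶠ t in atTop, ∀ j, j ∉ activeCoords xs → 0 < x t j := by
  refine eventually_all.2 fun j => ?_
  by_cases hj : j ∈ activeCoords xs
  · exact Eventually.of_forall fun t h => absurd hj h
  · have h0 : xs j ≠ 0 := fun h0 => hj (Finset.mem_filter.2 ⟨Finset.mem_univ j, h0⟩)
    filter_upwards [(tendsto_pi_nhds.1 hx j).eventually
      (lt_mem_nhds (lt_of_le_of_ne (hX xs hxs j) h0.symm))] with t ht _ using ht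

variable {γ L : ℝ} {x y : ℕ → Fin n → ℝ}

lemma eventually_eq_zero_of_lowerBound (hreg : IsBregmanRegularizer (polyhedron A b) N h g)
    (hd : IsDecomposable (polyhedron A b) h θ) (hS : HasSlaterPoint (polyhedron A b))
    (hxs : xs ∈ polyhedron A b) {M : ℝ} (hM : ∀ z, 0 < z → M ≤ deriv θ z)
    (hN : ∀ x, N x = 0 → x = 0) (hF : LipschitzField (polyhedron A b) N F L) (hγ : 0 < γ)
    (hnext : ∀ t, 1 ≤ t → IsProx (polyhedron A b) h g (x t) (-(γ • F (y t))) (x (t + 1)))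
    (hx : Tendsto x atTop (𝓝 xs)) (hyX : ∀ t, y t ∈ polyhedron A b)
    (hy : Tendsto y atTop (𝓝 xs)) (hs : IsSlackness A xs (F xs) s)
    {i : Fin n} (hi : i ∈ sharpCoords xs s) : ∀ᶠ t in atTop, x t i = 0 := by
  have hia := (Finset.mem_filter.1 hi).1
  obtain ⟨κ, hκ0, hκ⟩ := exists_ratio_bound (faceDirection (polyhedron A b) xs)
  set w := faceDirection (polyhedron A b) xs
  have hgc : Tendsto (fun t => g (x t)) atTop (𝓝 (g xs)) := by
    refine (hreg.selection_continuousOn xs (mem_proxDomain_of_lowerBound hd hM hxs)).tendsto.comp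
      (tendsto_nhdsWithin_iff.2 ⟨hx, ?_⟩)
    filter_upwards [eventually_ge_atTop 1] with t ht using (hnext t ht).1
  have hpos : ∀ σ, ∀ᶠ t in atTop, 0 < F xs ⬝ᵥ w σ →
      0 < (g (x (t + 1)) - g (x t) + γ • F (y t)) ⬝ᵥ w σ := by
    intro σ
    by_cases hσ : 0 < F xs ⬝ᵥ w σ
    · have hcont : Continuous fun v : Fin n → ℝ => v ⬝ᵥ w σ := by fun_prop
      have h1 := (hcont.tendsto _).comp (((tendsto_add_atTop_iff_nat 1).2 hgc).sub hgc)
      have h2 := h1.add ((hF.tendsto_dotProduct hN hxs hyX hy (w σ)).const_mul γ)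
      rw [sub_self, zero_dotProduct, zero_add] at h2
      filter_upwards [h2.eventually (lt_mem_nhds (mul_pos hγ hσ))] with t ht _
      simpa [add_dotProduct, smul_dotProduct] using ht
    · exact Eventually.of_forall fun t h => absurd h hσ
  rw [← map_add_atTop_eq_nat 1, eventually_map]
  filter_upwards [eventually_all.2 hpos, eventually_ge_atTop 1, (tendsto_add_atTop_nat 1).eventually
    (eventually_pos_of_notMem_activeCoords polyhedron_nonneg hxs hx)] with t h1 h2 h3
  have hp := hnext t h2
  by_contra hne
  have hxi : 0 < x (t + 1) i := lt_of_le_of_ne (hp.2.1.1 i) (Ne.symm hne)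
  obtain ⟨σ, hσ1, hσ2, hσ3, hσ4⟩ := exists_face_bound hxs hκ0 hκ hp.2.1 hia hxi
  -- Moving along `-w σ` is feasible: wherever `w σ` is positive on the active set, so is the
  -- iterate, and inactive coordinates are already positive. Testing the prox inequality there
  -- contradicts `h1`.
  obtain ⟨ε, hε, hε0⟩ := ((eventually_add_smul_mem_polyhedron (w := -w σ) hp.2.1
    (by rw [Matrix.mulVec_neg, hσ1, neg_zero]) (fun j hj => by
      have hja : j ∈ activeCoords xs := by
        by_contra hja
        exact (h3 j hja).ne' hj
      rw [Pi.neg_apply, neg_nonneg]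
      by_contra hwj
      have := hσ4 j hja (not_le.1 hwj)
      rw [hj] at this
      exact absurd this (not_le.2 (by positivity)))).and self_mem_nhdsWithin).exists
  have hle := hp.dotProduct_le hreg
    (fun x hx q hq l hl => segment_mem_proxDomain hd hS hx hq hl) hε
  have hε0' : 0 < ε := hε0
  have hlt := mul_pos hε0' (h1 σ (hs.dotProduct_pos hσ1 hσ2 hi hσ3))
  simp only [add_sub_cancel_left, smul_neg, dotProduct_neg, dotProduct_smul, neg_dotProduct,
    smul_dotProduct, smul_eq_mul, add_dotProduct] at hle hlt
  linarith

lemma eventually_deriv_le (hreg : IsBregmanRegularizer (polyhedron A b) N h g)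
    (hd : IsDecomposable (polyhedron A b) h θ) (hS : HasSlaterPoint (polyhedron A b))
    (hxs : xs ∈ polyhedron A b) (hθ : ∀ M, ∃ z, 0 < z ∧ deriv θ z < M)
    (hN : ∀ x, N x = 0 → x = 0) (hF : LipschitzField (polyhedron A b) N F L) (hγ : 0 < γ)
    (hnext : ∀ t, 1 ≤ t → IsProx (polyhedron A b) h g (x t) (-(γ • F (y t))) (x (t + 1)))
    (hx : Tendsto x atTop (𝓝 xs)) (hyX : ∀ t, y t ∈ polyhedron A b)
    (hy : Tendsto y atTop (𝓝 xs)) (hs : IsSlackness A xs (F xs) s)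
    {κ ρ : ℝ} (hκ0 : 0 < κ)
    (hκ : ∀ σ i j, 0 < faceDirection (polyhedron A b) xs σ i →
      0 < faceDirection (polyhedron A b) xs σ j →
      κ * faceDirection (polyhedron A b) xs σ i ≤ faceDirection (polyhedron A b) xs σ j)
    (hρ : 1 ≤ ρ) (hρκ : n / κ ≤ ρ) {i : Fin n} (hi : i ∈ sharpCoords xs s) :
    (∀ᶠ t in atTop, 0 < x t i) ∧ ∃ C, ∀ᶠ t : ℕ in atTop,
      deriv θ (κ / 2 ^ n * x t i) ≤ C - γ * effSharpness ρ xs s * t / 2 := by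
  have hia := (Finset.mem_filter.1 hi).1
  set w := faceDirection (polyhedron A b) xs
  have hxpos : ∀ t, 1 ≤ t → ∀ j, 0 < x t j := fun t ht j =>
    pos_of_mem_proxDomain hd hS hθ (hnext t ht).1 j
  have hxX : ∀ t, 1 ≤ t → x t ∈ polyhedron A b := fun t ht => proxDomain_subset (hnext t ht).1
  refine ⟨by filter_upwards [eventually_ge_atTop 1] with t ht using hxpos t ht i, ?_⟩
  set μ := effSharpness ρ xs s with hμ
  have hμ0 : 0 < μ := effSharpness_pos hρ hi
  have hη : 0 < κ / 2 ^ n := by positivity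
  have hstep : ∀ t, 1 ≤ t → ∀ v, A *ᵥ v = 0 →
      g (x (t + 1)) ⬝ᵥ v = g (x t) ⬝ᵥ v - γ * (F (y t) ⬝ᵥ v) := by
    have hle : ∀ t, 1 ≤ t → ∀ v, A *ᵥ v = 0 →
        g (x t) ⬝ᵥ v - γ * (F (y t) ⬝ᵥ v) ≤ g (x (t + 1)) ⬝ᵥ v := by
      intro t ht v hv
      obtain ⟨ε, hε, hε0⟩ := ((eventually_add_smul_mem_polyhedron (w := v)
        (hxX (t + 1) (by omega)) hv (fun j hj =>
          absurd hj (hxpos (t + 1) (by omega) j).ne')).and self_mem_nhdsWithin).exists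
      have hle := (hnext t ht).dotProduct_le hreg
        (fun x hx q hq l hl => segment_mem_proxDomain hd hS hx hq hl) hε
      have hε0' : 0 < ε := hε0
      simp only [add_sub_cancel_left, dotProduct_smul, neg_dotProduct, sub_dotProduct,
        smul_dotProduct, smul_eq_mul] at hle
      have := le_of_mul_le_mul_left hle hε0'
      linarith
    -- Iterates are positive, so `v` and `-v` are both feasible and the inequality becomes an
    -- equality.
    intro t ht v hv
    refine le_antisymm ?_ (hle t ht v hv)
    have := hle t ht (-v) (by rw [Matrix.mulVec_neg, hv, neg_zero])
    simp only [dotProduct_neg] at this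
    linarith
  have hσ : ∀ σ, ∃ C, ∀ᶠ t : ℕ in atTop, A *ᵥ w σ = 0 → (∀ j ∈ activeCoords xs, 0 ≤ w σ j) →
      0 < w σ i → (∀ j ∈ activeCoords xs, 0 < w σ j → κ / 2 ^ n * x t i ≤ x t j) →
      deriv θ (κ / 2 ^ n * x t i) ≤ C - γ * μ * t / 2 := by
    intro σ
    by_cases hcond : A *ᵥ w σ = 0 ∧ (∀ j ∈ activeCoords xs, 0 ≤ w σ j) ∧ 0 < w σ i
    swap
    · exact ⟨0, Eventually.of_forall fun t h1 h2 h3 => absurd ⟨h1, h2, h3⟩ hcond⟩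
    obtain ⟨hσ1, hσ2, hσ3⟩ := hcond
    set W := ∑ j ∈ activeCoords xs, w σ j with hW
    have hW0 : 0 < W := hσ3.trans_le (Finset.single_le_sum (f := w σ) hσ2 hia)
    have hWρ : W ≤ ρ * w σ i := by
      calc W ≤ ∑ j ∈ activeCoords xs, w σ i / κ := by
            refine Finset.sum_le_sum fun j hj => ?_
            rw [le_div_iff₀' hκ0]
            rcases (hσ2 j hj).eq_or_lt with h0 | h0
            · rw [← h0, mul_zero]
              exact hσ3.le
            · exact hκ σ j i h0 hσ3
        _ = (activeCoords xs).card * (w σ i / κ) := by rw [Finset.sum_const, nsmul_eq_mul]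
        _ ≤ n * (w σ i / κ) := by
            have : (activeCoords xs).card ≤ n := by
              simpa using Finset.card_le_univ (activeCoords xs)
            gcongr
        _ = n / κ * w σ i := by ring
        _ ≤ ρ * w σ i := by gcongr
    have hμW : μ * W ≤ F xs ⬝ᵥ w σ := by
      rw [hs.dotProduct_eq hσ1]
      exact hs.effSharpness_mul_sum_le hρ hσ2 hi hWρ
    have hμW0 : 0 < μ * W := mul_pos hμ0 hW0
    -- Giving up half of the limiting drift is the source of the factor `1 / 2` in the rates.
    have hFev : ∀ᶠ t in atTop, μ * W / 2 < F (y t) ⬝ᵥ w σ :=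
      (hF.tendsto_dotProduct hN hxs hyX hy (w σ)).eventually (lt_mem_nhds (by linarith))
    obtain ⟨T, hT⟩ := eventually_atTop.1 (hFev.and (eventually_ge_atTop 1))
    have htele : ∀ k, g (x (T + k)) ⬝ᵥ w σ ≤ g (x T) ⬝ᵥ w σ - γ * (μ * W / 2) * k := by
      intro k
      induction k with
      | zero => simp
      | succ k ih =>
        obtain ⟨h1, h2⟩ := hT (T + k) (by omega)
        rw [← add_assoc, hstep (T + k) h2 _ hσ1]
        have := mul_le_mul_of_nonneg_left h1.le hγ.le
        push_cast
        linarith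
    set I : (Fin n → ℝ) → ℝ := fun x =>
      ∑ j ∈ Finset.univ.filter (· ∉ activeCoords xs), deriv θ (x j) * w σ j with hI
    have hIlim : Tendsto (fun t => I (x t)) atTop (𝓝 (I xs)) := by
      refine tendsto_finsetSum _ fun j hj => Tendsto.mul_const _ ?_
      have h0 : xs j ≠ 0 := fun h0 =>
        (Finset.mem_filter.1 hj).2 (Finset.mem_filter.2 ⟨Finset.mem_univ j, h0⟩)
      have h1 : 0 < xs j := lt_of_le_of_ne (hxs.1 j) h0.symm
      exact (hd.continuousOn_deriv.continuousAt (Ioi_mem_nhds h1)).tendsto.comp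
        (tendsto_pi_nhds.1 hx j)
    -- The term `I xs - 1` is an eventual lower bound for the contribution of the inactive
    -- coordinates, which converges.
    refine ⟨(g (x T) ⬝ᵥ w σ + γ * (μ * W / 2) * T - (I xs - 1)) / W, ?_⟩
    filter_upwards [eventually_ge_atTop T, eventually_ge_atTop 1,
      hIlim.eventually (lt_mem_nhds (sub_one_lt (I xs)))] with t ht ht1 hIt _ _ _ hle
    obtain ⟨k, rfl⟩ := Nat.exists_eq_add_of_le ht
    have hψ := htele k
    rw [selection_dotProduct hreg hd (hxX _ ht1) (hxpos _ ht1) hσ1,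
      ← Finset.sum_filter_add_sum_filter_not Finset.univ (· ∈ activeCoords xs),
      Finset.filter_univ_mem] at hψ
    have hlow : deriv θ (κ / 2 ^ n * x (T + k) i) * W ≤
        ∑ j ∈ activeCoords xs, deriv θ (x (T + k) j) * w σ j := by
      rw [hW, Finset.mul_sum]
      refine Finset.sum_le_sum fun j hj => ?_
      rcases (hσ2 j hj).eq_or_lt with h0 | h0
      · simp [← h0]
      · refine mul_le_mul_of_nonneg_right (hd.monotoneOn_deriv ?_ (hxpos _ ht1 j) (hle j hj h0))
          h0.le
        exact mul_pos hη (hxpos _ ht1 i)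
    rw [← sub_nonneg, ← mul_nonneg_iff_of_pos_right hW0, sub_mul, sub_mul,
      div_mul_cancel₀ _ hW0.ne']
    simp only [hI] at hIt
    push_cast
    linarith
  choose C hC using hσ
  -- The direction `σ` may change with `t`; finiteness of the family gives one constant for all of
  -- them.
  refine ⟨∑ σ, |C σ|, ?_⟩
  filter_upwards [eventually_all.2 hC, eventually_ge_atTop 1] with t h1 h2
  obtain ⟨σ, hσ1, hσ2, hσ3, hσ4⟩ :=
    exists_face_bound hxs hκ0 hκ (hxX t h2) hia (hxpos t h2 i)
  have := h1 σ hσ1 hσ2 hσ3 hσ4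
  have := Finset.single_le_sum (f := fun σ => |C σ|) (fun σ _ => abs_nonneg _) (Finset.mem_univ σ)
  have := le_abs_self (C σ)
  linarith

end SharpCoordinates

/-! ### Neighborhood radius, step-size constant and the main theorem -/

lemma exists_seminorm_ball_subset {X B : Set (Fin n → ℝ)} {N : Seminorm ℝ (Fin n → ℝ)}
    (hN : ∀ x, N x = 0 → x = 0) {xs : Fin n → ℝ} (hB : B ∈ 𝓝[X] xs) :
    ∃ r > 0, ∀ x ∈ X, N (x - xs) ≤ r → x ∈ B := by
  obtain ⟨c, hc, hcN⟩ := exists_mul_norm_le_seminorm N hN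
  obtain ⟨ε, hε, hsub⟩ := Metric.mem_nhdsWithin_iff.1 hB
  refine ⟨c * (ε / 2), by positivity, fun x hx hxr => hsub ⟨?_, hx⟩⟩
  rw [Metric.mem_ball, dist_eq_norm]
  have := le_of_mul_le_mul_left ((hcN _).trans hxr) hc
  linarith

lemma mul_le_of_le_goldenRatio {γ L : ℝ} (hL : 0 < L)
    (h : γ ≤ 1 / (2 * Real.goldenRatio * L)) : γ * L ≤ 5 / 16 := by
  have hφ : 8 / 5 ≤ Real.goldenRatio := by
    have : (11 : ℝ) / 5 ≤ √5 := Real.le_sqrt_of_sq_le (by norm_num)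
    rw [Real.goldenRatio]
    linarith
  rw [le_div_iff₀ (by positivity)] at h
  nlinarith

end BregmanProx

open BregmanProx

theorem theorem2 {n : ℕ} (X : Set (Fin n → ℝ)) (xs : Fin n → ℝ) :
    ∃ ρ : ℝ, 1 ≤ ρ ∧
      ∀ (m : ℕ) (A : Matrix (Fin m) (Fin n) ℝ) (b : Fin m → ℝ),
        X = BregmanProx.polyhedron A b → BregmanProx.HasSlaterPoint X →
      ∀ N : Seminorm ℝ (Fin n → ℝ), (∀ x, N x = 0 → x = 0) →
      ∀ (h : (Fin n → ℝ) → ℝ) (g : (Fin n → ℝ) → (Fin n → ℝ)) (θ : ℝ → ℝ),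
        BregmanProx.IsBregmanRegularizer X N h g → BregmanProx.IsDecomposable X h θ →
      ∀ (F : (Fin n → ℝ) → (Fin n → ℝ)) (L α : ℝ),
        BregmanProx.IsVISolution X F xs →
        0 < L → BregmanProx.LipschitzField X N F L →
        BregmanProx.SecondOrderSufficient X N F xs α →
      ∃ U ∈ 𝓝 xs,
        ∀ (ca cb γ : ℝ), BregmanProx.AdmissibleSignal ca cb →
          0 < γ → γ ≤ 1 / (2 * Real.goldenRatio * L) →
          γ * (1 - ca - cb) ^ 2 ≤ α / (8 * L ^ 2) →
        ∀ (x y : ℕ → (Fin n → ℝ)), BregmanProx.IsBPMRun X h g F ca cb γ x y → x 1 ∈ U →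
        ∀ s : Fin n → ℝ, BregmanProx.IsSlackness A xs (F xs) s →
        ∀ i ∈ BregmanProx.sharpCoords xs s,
          (BregmanProx.EuclideanLike θ → ∃ T : ℕ, 1 ≤ T ∧ ∀ t, T ≤ t → x t i = 0) ∧
          (BregmanProx.EntropyLike θ →
            (fun t : ℕ => x t i) =O[atTop]
              fun t : ℕ => Real.exp (-(γ * BregmanProx.effSharpness ρ xs s * t / 2))) ∧
          (∀ q : ℝ, 0 < q → q < 1 → BregmanProx.PowerLike q θ →
            (fun t : ℕ => x t i) =O[atTop]
              fun t : ℕ => (γ * BregmanProx.effSharpness ρ xs s * t / 2) ^ (-(1 / q))) := by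
  -- The directions are defined from `X` and `xs` alone, so `ρ` can be fixed before `A`, `b`, the
  -- norm, the regularizer and `F`.
  obtain ⟨κ, hκ0, hκ⟩ := exists_ratio_bound (faceDirection X xs)
  refine ⟨max 1 (n / κ), le_max_left _ _, ?_⟩
  rintro m A b rfl hS N hN h g θ hreg hd F L α hvi hL hF ⟨hα, B, -, -, hB, hmono⟩
  have hxs := hvi.1
  obtain ⟨r, hr, hrB⟩ := exists_seminorm_ball_subset hN hB
  -- The threshold `r² / 20` is the one required by `lead_mem_ball`; it does not involve the
  -- step-size or the signal coefficients.
  refine ⟨_, eventually_bregDiv_le hreg hd hxs (show 0 < r ^ 2 / 20 by positivity), ?_⟩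
  intro ca cb γ hac hγ hγφ hγα x y hrun hx1 s hs i hi
  have hseg := fun x hx q hq l hl => segment_mem_proxDomain (x := x) (q := q) (l := l) hd hS hx hq hl
  obtain ⟨hx, hy⟩ := run_tendsto hN hreg hseg hvi hL hF hα hr
    (fun x hx hxr => hmono x (hrB x hx hxr)) hac hγ (mul_le_of_le_goldenRatio hL hγφ) hγα hrun
    (hx1 (hrun.next 1 le_rfl).1)
  have hyX : ∀ t, y t ∈ polyhedron A b := by
    rintro (_ | t)
    · rw [hrun.init]
      exact proxDomain_subset (hrun.next 1 le_rfl).1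
    · exact (hrun.lead (t + 1) (by omega)).2.1
  -- The split is on boundedness of `θ'` below, not on the three kernel types: boundedness gives
  -- eventual vanishing and hence every conclusion, while unboundedness excludes the Euclidean-like
  -- case.
  by_cases hθ : ∀ M, ∃ z, 0 < z ∧ deriv θ z < M
  · obtain ⟨hpos, C, hC⟩ := eventually_deriv_le hreg hd hS hxs hθ hN hF hγ hrun.next hx hyX hy hs
      hκ0 hκ (le_max_left 1 (n / κ)) (le_max_right _ _) hi
    have hμ := effSharpness_pos (le_max_left 1 (n / κ)) hi
    have hxi : Tendsto (fun t => x t i) atTop (𝓝 0) := by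
      have := tendsto_pi_nhds.1 hx i
      rwa [(Finset.mem_filter.1 (Finset.mem_filter.1 hi).1).2] at this
    have hη : 0 < κ / 2 ^ n := by positivity
    refine ⟨fun hE => ?_, fun hE => hE.isBigO hη hpos hxi hC, fun q hq _ hP =>
      hP.isBigO hq hη hpos hxi hC ?_⟩
    · exfalso
      obtain ⟨M, hM⟩ := exists_lt_of_bot_lt_liminf hE
      obtain ⟨z, hz, hzM⟩ := hθ M
      obtain ⟨z', hz', h0, h1⟩ := (hM.and (Ioo_mem_nhdsGT hz)).exists
      exact absurd (hz'.trans_le (hd.monotoneOn_deriv h0 hz h1.le)) hzM.not_gt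
    · exact (tendsto_natCast_atTop_atTop.const_mul_atTop (mul_pos hγ hμ)).atTop_div_const two_pos
  · push Not at hθ
    obtain ⟨M, hM⟩ := hθ
    have hzero := eventually_eq_zero_of_lowerBound hreg hd hS hxs hM hN hF hγ hrun.next hx hyX hy
      hs hi
    have hO : ∀ f : ℕ → ℝ, (fun t => x t i) =O[atTop] f := fun f =>
      (IsBigO.of_bound 0 (by filter_upwards [hzero] with t ht; simp [ht]))
    refine ⟨fun _ => ?_, fun _ => hO _, fun q _ _ _ => hO _⟩
    obtain ⟨T, hT⟩ := eventually_atTop.1 hzero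
    exact ⟨max T 1, le_max_right _ _, fun t ht => hT t ((le_max_left _ _).trans ht)⟩
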